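/- **Setting and notation.** Let $\Sigma_p,\Sigma_q$ be positive definite $d\times d$ matrices and $\mu^*\in\mathbb R^d$. The null hypothesis is the Gaussian location family $\mathcal P=\{P_\mu=N(\mu,\Sigma_p):\mu\in\mathbb R^d\}$, the alternative is $Q=N(\mu^*,\Sigma_q)$; $p_\mu,q$ denote their Lebesgue densities, extended to $n\ge 1$ outcomes $U^n=(U_1,\dots,U_n)$ by the i.i.d. assumption, and $\mathcal P(U^n)$ the set of the resulting distributions of $U^n$. For a prior $W$ on $\mathbb R^d$ put $p_W(U^n)=\int p_\mu(U^n)\,dW(\mu)$. Let $R$ be a probability distribution on $\mathbb R^d$ with finite second moments, mean $\mu^*$ and covariance matrix $\Sigma_r$; $\mathbb E_R$ refers to $U_1,U_2,\dots$ i.i.d. $\sim R$. In the statements about $\mathbb E_R$ of an e-variable that is only defined up to Lebesgue-null sets ($S_{\rm COND}$, $S_{\rm RIP}$), $R$ is assumed to have a Lebesgue density. Write $D_R(Q\|P)=\mathbb E_R[\log (q(U)/p(U))]$, $d_{rp}=\operatorname{tr}(\Sigma_r\Sigma_p^{-1})$, $D_{\rm gauss}(B)=\frac12(-\log\det B-(d-\operatorname{tr}B))$,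 and $D_{\Sigma_r}(\Sigma_q\|\Sigma_p)=D_{\rm gauss}(\Sigma_r\Sigma_p^{-1})-D_{\rm gauss}(\Sigma_r\Sigma_q^{-1})$. Let $\hat\mu_{|n}=n^{-1}\sum_{i=1}^n U_i$ and $Z=n^{-1/2}\sum_{i=1}^n U_i$. The *reverse information projection* (RIPr) of a distribution $Q'$ on a set $\mathcal C$ of distributions with $\inf_{P\in\mathcal C}D(Q'\|P)<\infty$ is the sub-probability distribution whose density $\hat p$ satisfies $\log p_k\to\log\hat p$ in $L^1(Q')$ for every sequence $P_k\in\mathcal C$ (with densities $p_k$) with $D(Q'\|P_k)\to\inf_{P\in\mathcal C}D(Q'\|P)$. Put $$S_{\rm UI}^{(n)}=\frac{q(U^n)}{\sup_\mu p_\mu(U^n)},\qquad S_{\rm COND}^{(n)}=\frac{q(U^n\mid Z)}{p(U^n\mid Z)},\qquad S_{\rm RIP}^{(n)}=\frac{q(U^n)}{\hat p(U^n)},\qquad S_{\rm seq\text{-}RIP}^{(n)}=\prod_{i=1}^n\frac{q(U_i)}{\hat p_1(U_i)},$$ where $p(\cdot\mid Z)$, $q(\cdot\mid Z)$ are densities,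 relative to a common measure (which may depend on $Z$), of regular conditional distributions of $U^n$ given $Z$ (the first being common to all $P_\mu$), $\hat p$ is the density of the RIPr of $Q(U^n)$ on the convex hull of $\mathcal P(U^n)$, and $\hat p_1$ that of the RIPr of $Q(U_1)$ on the convex hull of $\mathcal P(U_1)$. Below, equalities involving $S_{\rm RIP}$, $S_{\rm seq\text{-}RIP}$ and $S_{\rm COND}$ hold Lebesgue-almost everywhere, for all versions; such versions exist in each case. **Theorem.** $D_R(Q\|P_{\mu^*})$ is finite, and for all $n\ge1$: 1. (UI) $S_{\rm UI}^{(n)}=q(U^n)/p_{\hat\mu_{|n}}(U^n)$ and $\mathbb E_R[\log S_{\rm UI}^{(n)}]=n D_R(Q\|P_{\mu^*})-\frac{d_{rp}}2$. 2. (COND) $\mathbb E_R[\log S_{\rm COND}^{(n)}]=(n-1)D_R(Q\|P_{\mu^*})=nD_R(Q\|P_{\mu^*})-D_{\Sigma_r}(\Sigma_q\|\Sigma_p)$. 3. (RIPr and seq-RIPr) If $\Sigma_q-\Sigma_p$ is negative semidefinite (simple case), then $S_{\rm RIP}^{(n)}=S_{\rm seq\text{-}RIP}^{(n)}=q(U^n)/p_{\mu^*}(U^n)$,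 this is growth-rate optimal (it is an e-variable for $\mathcal P(U^n)$ and maximizes $\mathbb E_Q[\log S]$ among all such e-variables $S$), and $\mathbb E_R[\log S_{\rm RIP}^{(n)}]=nD_R(Q\|P_{\mu^*})$. If $\Sigma_q-\Sigma_p$ is positive semidefinite (anti-simple case), then $S_{\rm seq\text{-}RIP}^{(n)}=1$. 4. (RIPr, anti-simple case) If $\Sigma_q-\Sigma_p$ is positive semidefinite, then, with the (possibly degenerate) Gaussian prior $W_0=N(\mu^*,(\Sigma_q-\Sigma_p)/n)$, $P_{W_0}$ is the RIPr of $Q(U^n)$ on the convex hull of $\mathcal P(U^n)$, $S_{\rm RIP}^{(n)}=q(U^n)/p_{W_0}(U^n)=S_{\rm COND}^{(n)}$, and this is growth-rate optimal. -/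

import Mathlib

open MeasureTheory ProbabilityTheory InformationTheory Filter Topology Matrix
open scoped ENNReal NNReal

namespace GaussEVar

noncomputable section

/-! ### E-power, e-variables, reverse information projections -/

section General

variable {Ω T : Type*} [MeasurableSpace Ω] [MeasurableSpace T]

/-- The expectation `E_R[log S]` of the logarithm of a `[0, ∞]`-valued variable, computed in the
extended reals as (expected positive part) minus (expected negative part). It is equal to a real
number exactly when both parts have finite expectation. -/
def ePower (R : Measure Ω) (S : Ω → ℝ≥0∞) : EReal :=
  ((∫⁻ x, (ENNReal.log (S x)).toENNReal ∂ R : ℝ≥0∞) : EReal)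
    - ((∫⁻ x, (-(ENNReal.log (S x))).toENNReal ∂ R : ℝ≥0∞) : EReal)

/-- Generalized Kullback-Leibler divergence `D_R(Q ‖ P) = E_R[log (q / p)]` of distributions with
densities `q` and `p`, under sampling distribution `R`. -/
def generalizedKL (R : Measure Ω) (q p : Ω → ℝ≥0∞) : EReal :=
  ePower R (fun x => q x / p x)

/-- `S` is an e-variable for the null hypothesis `H₀`. -/
def IsEVariable (H₀ : Set (Measure Ω)) (S : Ω → ℝ≥0∞) : Prop :=
  Measurable S ∧ ∀ P ∈ H₀, ∫⁻ x, S x ∂P ≤ 1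

/-- `S` is growth-rate optimal relative to `Q` among all e-variables for `H₀`. -/
def IsGrowthOptimal (Q : Measure Ω) (H₀ : Set (Measure Ω)) (S : Ω → ℝ≥0∞) : Prop :=
  IsEVariable H₀ S ∧ ∀ S' : Ω → ℝ≥0∞, IsEVariable H₀ S' → ePower Q S' ≤ ePower Q S

/-- `p` is (a version of) the density relative to `ν` of the reverse information projection of `Q`
on the set `C` of distributions: `D(Q ‖ P)` is finite for some `P ∈ C`, and `p` is the
sub-probability density to which the densities of every sequence in `C` whose divergence
`D(Q ‖ ·)` tends to its infimum over `C` converge, in the sense that their logarithms converge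
in `L¹(Q)`. -/
structure IsRIPr (ν Q : Measure Ω) (C : Set (Measure Ω)) (p : Ω → ℝ≥0∞) : Prop where
  measurable : Measurable p
  lintegral_le_one : ∫⁻ x, p x ∂ν ≤ 1
  pos : ∀ᵐ x ∂Q, p x ≠ 0
  finite : ∃ P ∈ C, klDiv Q P ≠ ∞
  tendsto : ∀ P : ℕ → Measure Ω, (∀ k, P k ∈ C) →
    Tendsto (fun k => klDiv Q (P k)) atTop (𝓝 (⨅ P' ∈ C, klDiv Q P')) →
    Tendsto (fun k => ∫⁻ x,
      ‖Real.log ((P k).rnDeriv ν x).toReal - Real.log (p x).toReal‖ₑ ∂Q) atTop (𝓝 0)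

/-- `S = q / p`, with `p` the density of the reverse information projection on the convex hull
of `H₀` of the distribution `Q` with density `q`. -/
def IsRIPrEVariable (ν Q : Measure Ω) (q : Ω → ℝ≥0∞) (H₀ : Set (Measure Ω))
    (S : Ω → ℝ≥0∞) : Prop :=
  ∃ p, IsRIPr ν Q (convexHull ℝ≥0 H₀) p ∧ S = fun x => q x / p x

/-- Sequentialized version for `n` outcomes that are i.i.d. under `Q`: the conditional
distribution of the `i`-th outcome given the past is `Q`, and it is projected on the convex hull
of the null hypothesis `H₀` for a single outcome. -/
def IsSeqRIPrEVariable (ν Q : Measure Ω) (q : Ω → ℝ≥0∞) (H₀ : Set (Measure Ω)) (n : ℕ)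
    (S : (Fin n → Ω) → ℝ≥0∞) : Prop :=
  ∃ p : Fin n → Ω → ℝ≥0∞, (∀ i, IsRIPr ν Q (convexHull ℝ≥0 H₀) (p i)) ∧
    S = fun u => ∏ i, q (u i) / p i (u i)

/-- `κ` is a regular conditional distribution of the data given the statistic `Z` under `P`. -/
def IsRegularCondDistrib (P : Measure Ω) (Z : Ω → T) (κ : Kernel T Ω) : Prop :=
  IsMarkovKernel κ ∧ (P.map Z) ⊗ₘ κ = P.map (fun u => (Z u, u))

/-- `S(u) = q(u | Z(u)) / p(u | Z(u))`, with `p(· | z)` and `q(· | z)` densities, relative to some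
common measures `ν' z`, of regular conditional distributions given `Z`: the first one being common
to all elements of `H₀`, the second one being that of `Q`. -/
def IsCondEVariable (H₀ : Set (Measure Ω)) (Q : Measure Ω) (Z : Ω → T)
    (S : Ω → ℝ≥0∞) : Prop :=
  ∃ (κP κQ ν' : Kernel T Ω) (p q : T → Ω → ℝ≥0∞),
    (∀ P ∈ H₀, IsRegularCondDistrib P Z κP) ∧ IsRegularCondDistrib Q Z κQ ∧
    Measurable (Function.uncurry p) ∧ Measurable (Function.uncurry q) ∧
    (∀ z, κP z = (ν' z).withDensity (p z)) ∧ (∀ z, κQ z = (ν' z).withDensity (q z)) ∧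
    S = fun u => q (Z u) u / p (Z u) u

end General

/-! ### Gaussian location families -/

section Gauss

variable {d : ℕ}

/-- Lebesgue density of the Gaussian distribution `N(m, Σ)` on `ℝ^d`, for positive definite `Σ`. -/
def density (m : EuclideanSpace ℝ (Fin d)) (Sig : Matrix (Fin d) (Fin d) ℝ)
    (x : EuclideanSpace ℝ (Fin d)) : ℝ≥0∞ :=
  ENNReal.ofReal ((Real.sqrt ((2 * Real.pi) ^ d * Sig.det))⁻¹ *
    Real.exp (-(1 / 2) * ((x - m).ofLp ⬝ᵥ (Sig⁻¹ *ᵥ (x - m).ofLp))))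

/-- Density of `n` i.i.d. outcomes with distribution `N(m, Σ)`. -/
def densityN (m : EuclideanSpace ℝ (Fin d)) (Sig : Matrix (Fin d) (Fin d) ℝ) (n : ℕ)
    (u : Fin n → EuclideanSpace ℝ (Fin d)) : ℝ≥0∞ :=
  ∏ i, density m Sig (u i)

/-- Bayes marginal density `p_W(u^n) = ∫ p_m(u^n) dW(m)` for a prior `W` on the mean. -/
def mixtureN (W : Measure (EuclideanSpace ℝ (Fin d))) (Sig : Matrix (Fin d) (Fin d) ℝ) (n : ℕ)
    (u : Fin n → EuclideanSpace ℝ (Fin d)) : ℝ≥0∞ :=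
  ∫⁻ m, densityN m Sig n u ∂W

/-- The joint distribution of `n` i.i.d. outcomes with distribution `R`. -/
def iid {Ω : Type*} [MeasurableSpace Ω] (R : Measure Ω) (n : ℕ) : Measure (Fin n → Ω) :=
  Measure.pi (fun _ => R)

/-- The Gaussian location family with covariance matrix `Σ`, for a single outcome. -/
def locationFamily (Sig : Matrix (Fin d) (Fin d) ℝ) : Set (Measure (EuclideanSpace ℝ (Fin d))) :=
  Set.range (fun m => multivariateGaussian m Sig)

/-- The Gaussian location family with covariance matrix `Σ`, for `n` i.i.d. outcomes. -/
def locationFamilyN (Sig : Matrix (Fin d) (Fin d) ℝ) (n : ℕ) :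
    Set (Measure (Fin n → EuclideanSpace ℝ (Fin d))) :=
  Set.range (fun m => iid (multivariateGaussian m Sig) n)

/-- The maximum likelihood estimator, i.e. the sample mean. -/
def mle {n : ℕ} (u : Fin n → EuclideanSpace ℝ (Fin d)) : EuclideanSpace ℝ (Fin d) :=
  (n : ℝ)⁻¹ • ∑ i, u i

/-- The sufficient statistic `Z = n^{-1/2} ∑ X_i`. -/
def statZ {n : ℕ} (u : Fin n → EuclideanSpace ℝ (Fin d)) : EuclideanSpace ℝ (Fin d) :=
  (Real.sqrt n)⁻¹ • ∑ i, u i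

/-- The universal inference e-variable `q(u^n) / sup_m p_m(u^n)` of `Q = N(μ, Σq)` against the
Gaussian location family with covariance matrix `Σp`. -/
def uiEVariable (μ : EuclideanSpace ℝ (Fin d)) (Sp Sq : Matrix (Fin d) (Fin d) ℝ) (n : ℕ)
    (u : Fin n → EuclideanSpace ℝ (Fin d)) : ℝ≥0∞ :=
  densityN μ Sq n u / ⨆ m, densityN m Sp n u

/-- `d_{ab} = tr (Σa Σb⁻¹)`. -/
def dTr (Sa Sb : Matrix (Fin d) (Fin d) ℝ) : ℝ := (Sa * Sb⁻¹).trace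

/-- `D_gauss(B) = (- log det B - (d - tr B)) / 2`. -/
def DGauss (B : Matrix (Fin d) (Fin d) ℝ) : ℝ :=
  (1 / 2) * (-Real.log B.det - ((d : ℝ) - B.trace))

/-- `D_{Σr}(Σq ‖ Σp) = D_gauss(Σr Σp⁻¹) - D_gauss(Σr Σq⁻¹)`. -/
def DSigma (Sr Sq Sp : Matrix (Fin d) (Fin d) ℝ) : ℝ :=
  DGauss (Sr * Sp⁻¹) - DGauss (Sr * Sq⁻¹)

end Gauss

end

end GaussEVar

namespace GaussEVar

/-! ### Expected logarithms and growth-rate optimality -/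

section General

variable {Ω T : Type*} [MeasurableSpace Ω] [MeasurableSpace T]

/-! The logarithms of all e-variables involved are quadratic in the data, so their expectations
under `R` depend only on its mean and covariance. Completing the square gives p_m(u) = c(u) ·
φ_m(Z), where c does not involve m and φ_m is the density of N(√n m, Σp) at Z
(`logDensityN_sub_logDensityN`). Under `R` the statistic Z has mean √n μ and the covariance of a
single outcome, so replacing one outcome by Z leaves the expected log-ratio D unchanged. Three facts
follow. Replacing μ by the maximum likelihood estimator costs half the expectation of a quadratic
form in Z - √n μ, which is d_rp / 2. Conditioning on Z divides q / p_μ by the likelihood ratio of Z,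
which costs D. The conditional quotient is an e-variable because all P_m agree given Z.

Projections and optimality rest on one criterion. Suppose that q / p has expectation at most one
under the whole null hypothesis, hence under its convex hull, and that some P in the hull have D(Q ‖
P) arbitrarily close to E_Q[log (q / p)]. Then p is the reverse information projection
(`isRIPr_of_lintegral_div_le_one`). Indeed, if r is the density of P and G = log (r / p), then
E_Q[exp G] = E_P[q / p] ≤ 1, while -E_Q[G] is the divergence gap. A small gap thus makes E_Q[exp G -
1 - G] small, and this controls E_Q|G|. Optimality uses the same inequality t + 1 ≤ exp t: E_Q[S' /
S] ≤ 1 implies E_Q[log S'] ≤ E_Q[log S], and for S = q / p this follows from ∫ S' p ≤ 1.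

In the simple case p = p_μ lies in the null hypothesis, and the e-variable condition is a Gaussian
moment generating function computation (`lintegral_density_div_density_le_one`). In the anti-simple
case the prior N(μ, (Σq - Σp) / n) on m gives √n m the covariance Σq - Σp, so that Z gets the same
law N(√n μ, Σq) as under Q. The mixture therefore has the density q(Z) p(u | Z), and q divided by it
is the conditional e-variable (`mixtureN_ae_eq`). For a single outcome the mixture is Q itself and
the quotient is 1. The convex hull contains only finite mixtures, so closeness in divergence needs
an approximation (`exists_mem_convexHull_klDiv_le`). -/

theorem lintegral_withDensity_mul {ν : Measure Ω} {q g : Ω → ℝ≥0∞} (hq : Measurable q)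
    (hg : Measurable g) : ∫⁻ x, g x ∂(ν.withDensity q) = ∫⁻ x, q x * g x ∂ν :=
  lintegral_withDensity_eq_lintegral_mul _ hq hg

/-- The expected logarithm of a positive variable with integrable logarithm. -/
theorem ePower_eq_integral {R : Measure Ω} {S : Ω → ℝ≥0∞} {L : Ω → ℝ}
    (hS : ∀ᵐ x ∂ R, S x = ENNReal.ofReal (Real.exp (L x))) (hL : Integrable L R) :
    ePower R S = ((∫ x, L x ∂ R : ℝ) : EReal) := by
  have hlog : ∀ᵐ x ∂ R, ENNReal.log (S x) = ((L x : ℝ) : EReal) := by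
    filter_upwards [hS] with x hx
    rw [hx, ENNReal.log_ofReal_of_pos (Real.exp_pos _), Real.log_exp]
  have h1 : ∫⁻ x, (ENNReal.log (S x)).toENNReal ∂ R = ∫⁻ x, ENNReal.ofReal (L x) ∂ R := by
    refine lintegral_congr_ae ?_
    filter_upwards [hlog] with x hx
    rw [hx, EReal.real_coe_toENNReal]
  have h2 : ∫⁻ x, (-(ENNReal.log (S x))).toENNReal ∂ R = ∫⁻ x, ENNReal.ofReal (-L x) ∂ R := by
    refine lintegral_congr_ae ?_
    filter_upwards [hlog] with x hx
    rw [hx, ← EReal.coe_neg, EReal.real_coe_toENNReal]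
  have f1 : ∫⁻ x, ENNReal.ofReal (L x) ∂ R ≠ ∞ := hL.lintegral_lt_top.ne
  have f2 : ∫⁻ x, ENNReal.ofReal (-L x) ∂ R ≠ ∞ := hL.neg.lintegral_lt_top.ne
  rw [ePower, h1, h2, integral_eq_lintegral_pos_part_sub_lintegral_neg_part hL, EReal.coe_sub,
    EReal.coe_ennreal_toReal f1, EReal.coe_ennreal_toReal f2]

/-- Among the variables `S'` with `E_Q[S' / S] ≤ 1`, the variable `S` has maximal expected
logarithm. -/
theorem ePower_le_of_lintegral_div_le_one {Q : Measure Ω} [IsProbabilityMeasure Q]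
    {S S' : Ω → ℝ≥0∞} {L : Ω → ℝ} (hS : ∀ᵐ x ∂Q, S x = ENNReal.ofReal (Real.exp (L x)))
    (hL : Integrable L Q) (hS' : Measurable S') (h : ∫⁻ x, S' x / S x ∂Q ≤ 1) :
    ePower Q S' ≤ ePower Q S := by
  rw [ePower_eq_integral hS hL, ePower, integral_eq_lintegral_pos_part_sub_lintegral_neg_part hL,
    EReal.coe_sub]
  have f1 : ∫⁻ x, ENNReal.ofReal (L x) ∂Q ≠ ∞ := hL.lintegral_lt_top.ne
  have f2 : ∫⁻ x, ENNReal.ofReal (-L x) ∂Q ≠ ∞ := hL.neg.lintegral_lt_top.ne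
  rw [EReal.coe_ennreal_toReal f1, EReal.coe_ennreal_toReal f2]
  set a := ∫⁻ x, (ENNReal.log (S' x)).toENNReal ∂Q with ha
  set b := ∫⁻ x, (-(ENNReal.log (S' x))).toENNReal ∂Q with hb
  set p := ∫⁻ x, ENNReal.ofReal (L x) ∂Q
  set m := ∫⁻ x, ENNReal.ofReal (-L x) ∂Q
  -- If the negative part has infinite expectation, the convention for subtraction in `EReal` gives
  -- `⊥`, whatever the positive part is.
  by_cases hbt : b = ∞
  · simp [hbt]
  have hmS' : Measurable fun x => (ENNReal.log (S' x)).toENNReal := by fun_prop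
  have hmS'n : Measurable fun x => (-(ENNReal.log (S' x))).toENNReal := by fun_prop
  -- This is t + 1 ≤ L + exp (t - L) for t = log S', with positive and negative parts moved so that
  -- all terms lie in [0, ∞] and no integrability of log S' is needed.
  have hpt : ∀ᵐ x ∂Q, (ENNReal.log (S' x)).toENNReal + (ENNReal.ofReal (-L x) + 1)
      ≤ (-(ENNReal.log (S' x))).toENNReal + (ENNReal.ofReal (L x) + S' x / S x) := by
    filter_upwards [hS] with x hx
    rcases eq_or_ne (S' x) 0 with h0 | h0
    · simp [h0]
    rcases eq_or_ne (S' x) ∞ with ht | ht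
    · rw [ht, hx, ENNReal.top_div_of_ne_top ENNReal.ofReal_ne_top]
      simp
    have hpos := ENNReal.toReal_pos h0 ht
    obtain ⟨t, ht'⟩ : ∃ t, S' x = ENNReal.ofReal (Real.exp t) :=
      ⟨Real.log (S' x).toReal, by rw [Real.exp_log hpos, ENNReal.ofReal_toReal ht]⟩
    rw [hx, ht', ENNReal.log_ofReal_of_pos (Real.exp_pos _), Real.log_exp,
      ← ENNReal.ofReal_div_of_pos (Real.exp_pos _), ← Real.exp_sub, ← EReal.coe_neg,
      EReal.real_coe_toENNReal, EReal.real_coe_toENNReal, ← ENNReal.ofReal_one]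
    have he := Real.add_one_le_exp (t - L x)
    have e1 : ∀ y : ℝ, ENNReal.ofReal y = ENNReal.ofReal (max y 0) := by
      intro y; simp [ENNReal.ofReal, Real.toNNReal]
    rw [e1 t, e1 (-L x), e1 (-t), e1 (L x), ← ENNReal.ofReal_add (by positivity) (by positivity),
      ← ENNReal.ofReal_add (by positivity) (by positivity),
      ← ENNReal.ofReal_add (by positivity) (by positivity),
      ← ENNReal.ofReal_add (by positivity) (by positivity)]
    apply ENNReal.ofReal_le_ofReal
    have m1 : max t 0 - max (-t) 0 = t := by
      rcases le_total t 0 with h | h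
      · rw [max_eq_right h, max_eq_left (by linarith)]; ring
      · rw [max_eq_left h, max_eq_right (by linarith)]; ring
    have m2 : max (L x) 0 - max (-L x) 0 = L x := by
      rcases le_total (L x) 0 with h | h
      · rw [max_eq_right h, max_eq_left (by linarith)]; ring
      · rw [max_eq_left h, max_eq_right (by linarith)]; ring
    linarith
  have hLm : AEMeasurable (fun x => ENNReal.ofReal (L x)) Q :=
    ENNReal.measurable_ofReal.comp_aemeasurable hL.aemeasurable
  have hLm' : AEMeasurable (fun x => ENNReal.ofReal (-L x)) Q :=
    ENNReal.measurable_ofReal.comp_aemeasurable hL.aemeasurable.neg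
  have hint := lintegral_mono_ae hpt
  rw [lintegral_add_left hmS', lintegral_add_left' hLm', lintegral_add_left hmS'n,
    lintegral_add_left' hLm, lintegral_const, measure_univ, mul_one] at hint
  have hfin : a + (m + 1) ≤ b + (p + 1) := hint.trans (by gcongr)
  have hat : a ≠ ∞ := by
    rintro hat
    rw [hat, top_add, top_le_iff] at hfin
    exact ENNReal.add_ne_top.2 ⟨hbt, ENNReal.add_ne_top.2 ⟨f1, ENNReal.one_ne_top⟩⟩ hfin
  clear_value a b p m
  lift a to ℝ≥0 using hat
  lift b to ℝ≥0 using hbt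
  lift p to ℝ≥0 using f1
  lift m to ℝ≥0 using f2
  have h' : (a : ℝ) + (m + 1) ≤ b + (p + 1) := by exact_mod_cast hfin
  have : ((a : ℝ) - b) ≤ ((p : ℝ) - m) := by linarith
  simp only [EReal.coe_nnreal_eq_coe_real, ← EReal.coe_sub]
  exact EReal.coe_le_coe_iff.2 this

/-- The quotient `q / p` is growth-rate optimal as soon as it is an e-variable and `p` is dominated
by the null hypothesis in the sense that `∫ S' p ≤ 1` for all e-variables `S'`. -/
theorem isGrowthOptimal_of_lintegral_mul_le_one {ν Q : Measure Ω} [IsProbabilityMeasure Q]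
    {q p : Ω → ℝ≥0∞} {L : Ω → ℝ} (hQ : Q = ν.withDensity q) (hq : Measurable q)
    (hp : Measurable p) (hS : ∀ᵐ x ∂Q, q x / p x = ENNReal.ofReal (Real.exp (L x)))
    (hL : Integrable L Q) {H₀ : Set (Measure Ω)} (hE : IsEVariable H₀ fun x => q x / p x)
    (h : ∀ S', IsEVariable H₀ S' → ∫⁻ x, S' x * p x ∂ν ≤ 1) :
    IsGrowthOptimal Q H₀ fun x => q x / p x := by
  refine ⟨hE, fun S' hS' => ePower_le_of_lintegral_div_le_one hS hL hS'.1 ?_⟩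
  calc ∫⁻ x, S' x / (q x / p x) ∂Q = ∫⁻ x, q x * (S' x / (q x / p x)) ∂ν := by
        rw [hQ]
        exact lintegral_withDensity_mul hq (hS'.1.div (hq.div hp))
    _ ≤ ∫⁻ x, S' x * p x ∂ν := by
        -- The formula for q / p is known only Q-almost everywhere, that is, ν-almost everywhere
        -- where q ≠ 0. Elsewhere the left integrand vanishes, which is why only an inequality
        -- holds.
        have hS2 : ∀ᵐ x ∂ν, q x ≠ 0 → q x / p x = ENNReal.ofReal (Real.exp (L x)) :=
          (ae_withDensity_iff hq).1 (hQ ▸ hS)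
        refine lintegral_mono_ae ?_
        filter_upwards [hS2] with x hx
        rcases eq_or_ne (q x) 0 with h0 | h0
        · simp [h0]
        have hx := hx h0
        have hne : q x / p x ≠ 0 := by
          rw [hx]; simp [Real.exp_pos]
        have hnt : q x / p x ≠ ∞ := by rw [hx]; exact ENNReal.ofReal_ne_top
        have hp0 : p x ≠ 0 := fun h => hnt (by rw [h, ENNReal.div_zero h0])
        have hpt : p x ≠ ∞ := fun h => hne (by rw [h, ENNReal.div_top])
        have hqt : q x ≠ ∞ := fun h => hnt (by rw [h, ENNReal.top_div_of_ne_top hpt])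
        rw [div_eq_mul_inv, ENNReal.inv_div (Or.inl hpt) (Or.inl hp0), mul_left_comm,
          ENNReal.mul_div_cancel h0 hqt]
    _ ≤ 1 := h S' hS'

/-- A quantitative form of the strict convexity of the exponential function. -/
theorem abs_le_add_exp_sub {ε s : ℝ} (hε : 0 < ε) (hε2 : ε ≤ 2) :
    |s| ≤ ε + 4 / ε * (Real.exp s - 1 - s) := by
  have h0 : 0 ≤ Real.exp s - 1 - s := by linarith [Real.add_one_le_exp s]
  have hr : 0 ≤ 4 / ε * (Real.exp s - 1 - s) := by positivity
  rcases le_or_gt |s| ε with h | h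
  · linarith
  -- For |s| > ε there are three ranges: exp s - 1 - s ≥ s² / 2 for s ≥ 0; it is at least s² / 4 on
  -- [-2, 0], by squaring exp (s / 2) ≥ 1 + s / 2; and for s < -2 it exceeds |s| - 1 ≥ |s| / 2. The
  -- last range uses ε ≤ 2.
  suffices h4 : |s| * ε ≤ 4 * (Real.exp s - 1 - s) by
    have : |s| ≤ 4 / ε * (Real.exp s - 1 - s) := by
      rw [div_mul_eq_mul_div, le_div_iff₀ hε]; exact h4
    linarith
  rcases le_total 0 s with hs | hs
  · rw [abs_of_nonneg hs] at h ⊢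
    nlinarith [Real.quadratic_le_exp_of_nonneg hs]
  · rw [abs_of_nonpos hs] at h ⊢
    rcases le_total (-2) s with h2 | h2
    · have h3 := Real.add_one_le_exp (s / 2)
      have h5 : Real.exp s = Real.exp (s / 2) * Real.exp (s / 2) := by
        rw [← Real.exp_add]; ring_nf
      nlinarith
    · nlinarith [Real.exp_pos s]

theorem quotient_ne_of_eq_ofReal_exp {a b : ℝ≥0∞} {l : ℝ}
    (h : a / b = ENNReal.ofReal (Real.exp l)) : a ≠ 0 ∧ a ≠ ∞ ∧ b ≠ 0 ∧ b ≠ ∞ := by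
  have hne : a / b ≠ 0 := by rw [h]; simp [Real.exp_pos]
  have hnt : a / b ≠ ∞ := by rw [h]; exact ENNReal.ofReal_ne_top
  have ha : a ≠ 0 := fun h => hne (by rw [h, ENNReal.zero_div])
  have hb : b ≠ ∞ := fun h => hne (by rw [h, ENNReal.div_top])
  exact ⟨ha, fun h => hnt (by rw [h, ENNReal.top_div_of_ne_top hb]),
    fun h => hnt (by rw [h, ENNReal.div_zero ha]), hb⟩

theorem eq_log_sub_log_of_eq_ofReal_exp {a b : ℝ≥0∞} {l : ℝ}
    (h : a / b = ENNReal.ofReal (Real.exp l)) : l = Real.log a.toReal - Real.log b.toReal := by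
  obtain ⟨h1, h2, h3, h4⟩ := quotient_ne_of_eq_ofReal_exp h
  rw [← Real.log_div (ENNReal.toReal_pos h1 h2).ne' (ENNReal.toReal_pos h3 h4).ne',
    ← ENNReal.toReal_div, h, ENNReal.toReal_ofReal (Real.exp_pos _).le, Real.log_exp]

/-! ### A criterion for reverse information projections -/

section RIPr

variable {ν Q : Measure Ω} [SigmaFinite ν] [IsProbabilityMeasure Q] {q p : Ω → ℝ≥0∞} {L : Ω → ℝ}

/-- If `P` has finite divergence and satisfies `E_P[q / p] ≤ 1`, then the `L¹(Q)` distance of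
the logarithms of its density and of `p` is controlled by the divergence gap. -/
theorem lintegral_enorm_log_sub_log_le (hQ : Q = ν.withDensity q) (hq : Measurable q)
    (hp : Measurable p) (hS : ∀ᵐ x ∂Q, q x / p x = ENNReal.ofReal (Real.exp (L x)))
    (hL : Integrable L Q) {P : Measure Ω} [IsProbabilityMeasure P] (hPν : P ≪ ν)
    (hE : ∫⁻ x, q x / p x ∂P ≤ 1) (hfin : klDiv Q P ≠ ∞) {ε : ℝ} (hε : 0 < ε) (hε2 : ε ≤ 2) :
    ∫⁻ x, ‖Real.log (P.rnDeriv ν x).toReal - Real.log (p x).toReal‖ₑ ∂Q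
      ≤ ENNReal.ofReal (ε + 4 / ε * ((klDiv Q P).toReal - ∫ x, L x ∂Q)) := by
  obtain ⟨hac, hllr⟩ := klDiv_ne_top_iff.1 hfin
  have hQν : Q ≪ ν := hac.trans hPν
  set r := P.rnDeriv ν with hr
  have hrm : Measurable r := Measure.measurable_rnDeriv P ν
  have hPr : P = ν.withDensity r := (Measure.withDensity_rnDeriv_eq P ν hPν).symm
  have hchain : ∀ᵐ x ∂Q, Q.rnDeriv P x * r x = q x := by
    have h1 := hQν.ae_le (Measure.rnDeriv_mul_rnDeriv (κ := ν) hac)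
    have h2 : Q.rnDeriv ν =ᵐ[Q] q := hQν.ae_le (by
      have := Measure.rnDeriv_withDensity ν hq
      rwa [← hQ] at this)
    filter_upwards [h1, h2] with x hx hx'
    rw [← hx', ← hx]; rfl
  -- Since q = (dQ/dP) · r, the function log (q / p) - log (dQ/dP) equals log (r / p).
  set G : Ω → ℝ := fun x => L x - llr Q P x with hG
  have hGi : Integrable G Q := hL.sub hllr
  have hGlog : ∀ᵐ x ∂Q, Real.log (r x).toReal - Real.log (p x).toReal = G x ∧
      r x / p x = ENNReal.ofReal (Real.exp (G x)) := by
    filter_upwards [hchain, hS] with x hx hSx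
    obtain ⟨q0, qt, p0, pt⟩ := quotient_ne_of_eq_ofReal_exp hSx
    have r0 : r x ≠ 0 := fun h => q0 (by rw [← hx, h, mul_zero])
    have d0 : Q.rnDeriv P x ≠ 0 := fun h => q0 (by rw [← hx, h, zero_mul])
    have rt : r x ≠ ∞ := fun h => qt (by rw [← hx, h, ENNReal.mul_top d0])
    have dt : Q.rnDeriv P x ≠ ∞ := fun h => qt (by rw [← hx, h, ENNReal.top_mul r0])
    have key : Real.log (r x).toReal - Real.log (p x).toReal = G x := by
      rw [hG]
      simp only [llr]
      rw [eq_log_sub_log_of_eq_ofReal_exp hSx, ← hx, ENNReal.toReal_mul,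
        Real.log_mul (ENNReal.toReal_pos d0 dt).ne' (ENNReal.toReal_pos r0 rt).ne']
      ring
    refine ⟨key, ?_⟩
    rw [← key, Real.exp_sub, Real.exp_log (ENNReal.toReal_pos r0 rt),
      Real.exp_log (ENNReal.toReal_pos p0 pt), ← ENNReal.toReal_div, ENNReal.ofReal_toReal]
    exact ENNReal.div_ne_top rt p0
  -- Interchanging the roles of q and r turns E_Q[r / p] into E_P[q / p].
  have hexp : ∫⁻ x, ENNReal.ofReal (Real.exp (G x)) ∂Q ≤ 1 := by
    calc ∫⁻ x, ENNReal.ofReal (Real.exp (G x)) ∂Q = ∫⁻ x, r x / p x ∂Q :=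
          lintegral_congr_ae (by filter_upwards [hGlog] with x hx using hx.2.symm)
      _ = ∫⁻ x, q x * (r x / p x) ∂ν := by
          rw [hQ]
          exact lintegral_withDensity_mul hq (hrm.div hp)
      _ = ∫⁻ x, r x * (q x / p x) ∂ν := by
          refine lintegral_congr fun x => ?_
          simp only [div_eq_mul_inv]; ring
      _ = ∫⁻ x, q x / p x ∂P := by
          conv_rhs => rw [hPr]
          exact (lintegral_withDensity_mul hrm (hq.div hp)).symm
      _ ≤ 1 := hE
  have hexpi : Integrable (fun x => Real.exp (G x)) Q := by
    refine ⟨Real.measurable_exp.comp_aemeasurable hGi.aemeasurable |>.aestronglyMeasurable, ?_⟩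
    rw [hasFiniteIntegral_iff_ofReal (ae_of_all _ fun x => (Real.exp_pos _).le)]
    exact hexp.trans_lt ENNReal.one_lt_top
  have hexp1 : ∫ x, Real.exp (G x) ∂Q ≤ 1 := by
    rw [integral_eq_lintegral_of_nonneg_ae (ae_of_all _ fun x => (Real.exp_pos _).le)
      hexpi.aestronglyMeasurable]
    exact ENNReal.toReal_le_of_le_ofReal zero_le_one (by simpa using hexp)
  have hkl : (klDiv Q P).toReal = ∫ x, llr Q P x ∂Q :=
    toReal_klDiv_of_measure_eq hac (by simp)
  calc ∫⁻ x, ‖Real.log (r x).toReal - Real.log (p x).toReal‖ₑ ∂Q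
      = ∫⁻ x, ENNReal.ofReal |G x| ∂Q := by
        refine lintegral_congr_ae ?_
        filter_upwards [hGlog] with x hx
        rw [hx.1, Real.enorm_eq_ofReal_abs]
    _ = ENNReal.ofReal (∫ x, |G x| ∂Q) :=
        (ofReal_integral_eq_lintegral_ofReal hGi.abs (ae_of_all _ fun x => abs_nonneg _)).symm
    _ ≤ _ := by
        apply ENNReal.ofReal_le_ofReal
        have hi : Integrable (fun x => Real.exp (G x) - 1 - G x) Q :=
          (hexpi.sub (integrable_const 1)).sub hGi
        have hI : ∫ x, (Real.exp (G x) - 1 - G x) ∂Q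
            = ∫ x, Real.exp (G x) ∂Q - 1 - (∫ x, L x ∂Q - ∫ x, llr Q P x ∂Q) := by
          have e1 := integral_sub (f := fun x => Real.exp (G x) - 1) (g := G)
            (hexpi.sub (integrable_const 1)) hGi
          have e2 := integral_sub hexpi (integrable_const (μ := Q) (1 : ℝ))
          have e3 : ∫ x, G x ∂Q = _ := integral_sub hL hllr
          rw [e1, e2, e3]
          simp
        calc ∫ x, |G x| ∂Q ≤ ∫ x, (ε + 4 / ε * (Real.exp (G x) - 1 - G x)) ∂Q :=
              integral_mono hGi.abs ((integrable_const _).add (hi.const_mul _))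
                fun x => abs_le_add_exp_sub hε hε2
          _ = ε + 4 / ε * ∫ x, (Real.exp (G x) - 1 - G x) ∂Q := by
              rw [integral_add (integrable_const _) (hi.const_mul _), integral_const_mul]
              simp
          _ ≤ _ := by
              rw [hI, hkl]
              have h4 : 0 ≤ 4 / ε := by positivity
              have := mul_le_mul_of_nonneg_left (by linarith : ∫ x, Real.exp (G x) ∂Q - 1 -
                (∫ x, L x ∂Q - ∫ x, llr Q P x ∂Q) ≤ ∫ x, llr Q P x ∂Q - ∫ x, L x ∂Q) h4
              linarith

/-- A sufficient condition for `p` to be the density of the reverse information projection. -/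
theorem isRIPr_of_lintegral_div_le_one (hQ : Q = ν.withDensity q) (hq : Measurable q)
    (hp : Measurable p) (hp1 : ∫⁻ x, p x ∂ν ≤ 1)
    (hS : ∀ᵐ x ∂Q, q x / p x = ENNReal.ofReal (Real.exp (L x))) (hL : Integrable L Q)
    {C : Set (Measure Ω)} (hC : ∀ P ∈ C, IsProbabilityMeasure P ∧ P ≪ ν)
    (hE : ∀ P ∈ C, ∫⁻ x, q x / p x ∂P ≤ 1)
    (happ : ∀ ε : ℝ, 0 < ε →
      ∃ P ∈ C, klDiv Q P ≠ ∞ ∧ (klDiv Q P).toReal ≤ ∫ x, L x ∂Q + ε) :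
    IsRIPr ν Q C p where
  measurable := hp
  lintegral_le_one := hp1
  pos := by
    filter_upwards [hS] with x hx using (quotient_ne_of_eq_ofReal_exp hx).2.2.1
  finite := by
    obtain ⟨P, hP, h, -⟩ := happ 1 one_pos
    exact ⟨P, hP, h⟩
  tendsto := by
    intro P hP htend
    set I := ⨅ P' ∈ C, klDiv Q P' with hI
    have hIle : ∀ P' ∈ C, I ≤ klDiv Q P' := fun P' h => iInf₂_le P' h
    have hIfin : I ≠ ∞ := by
      obtain ⟨P', hP', h, -⟩ := happ 1 one_pos
      exact ne_top_of_le_ne_top h (hIle P' hP')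
    -- Only this inequality is needed: it bounds each gap relative to ∫ L by the gap relative to the
    -- infimum.
    have hIL : I.toReal ≤ ∫ x, L x ∂Q := by
      refine le_of_forall_pos_le_add fun ε hε => ?_
      obtain ⟨P', hP', h, h'⟩ := happ ε hε
      exact (ENNReal.toReal_mono h (hIle P' hP')).trans h'
    have htr : Tendsto (fun k => (klDiv Q (P k)).toReal) atTop (𝓝 I.toReal) :=
      (ENNReal.tendsto_toReal hIfin).comp htend
    have hfin : ∀ᶠ k in atTop, klDiv Q (P k) ≠ ∞ :=
      (htend.eventually (gt_mem_nhds hIfin.lt_top)).mono fun k h => h.ne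
    rw [ENNReal.tendsto_nhds_zero]
    intro δ hδ
    obtain ⟨ε, hε, hε2, hεδ⟩ : ∃ ε : ℝ, 0 < ε ∧ ε ≤ 2 ∧ ENNReal.ofReal (2 * ε) ≤ δ := by
      rcases eq_or_ne δ ∞ with h | h
      · exact ⟨1, one_pos, one_le_two, by simp [h]⟩
      · have h0 : 0 < δ.toReal := ENNReal.toReal_pos hδ.ne' h
        refine ⟨min 2 (δ.toReal / 2), by positivity, min_le_left _ _, ?_⟩
        rw [ENNReal.ofReal_le_iff_le_toReal h]
        linarith [min_le_right 2 (δ.toReal / 2)]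
    -- A gap below ε² / 4 contributes at most ε after multiplication by 4 / ε, for a total of 2 ε ≤
    -- δ.
    have hsmall : ∀ᶠ k in atTop, (klDiv Q (P k)).toReal < I.toReal + ε * ε / 4 :=
      htr.eventually (gt_mem_nhds (by have : 0 < ε * ε / 4 := by positivity
                                      linarith))
    filter_upwards [hfin, hsmall] with k hk hk'
    have := (hC _ (hP k)).1
    refine (lintegral_enorm_log_sub_log_le hQ hq hp hS hL (hC _ (hP k)).2 (hE _ (hP k)) hk
      hε hε2).trans (le_trans (ENNReal.ofReal_le_ofReal ?_) hεδ)
    have : 4 / ε * ((klDiv Q (P k)).toReal - ∫ x, L x ∂Q) ≤ 4 / ε * (ε * ε / 4) := by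
      gcongr
      linarith
    have h2 : 4 / ε * (ε * ε / 4) = ε := by field_simp
    linarith

end RIPr

/-- Densities of reverse information projections are almost everywhere unique. -/
theorem IsRIPr.ae_eq {ν Q : Measure Ω} {C : Set (Measure Ω)} {p p' : Ω → ℝ≥0∞} (hQν : Q ≪ ν)
    (h : IsRIPr ν Q C p) (h' : IsRIPr ν Q C p') : p =ᵐ[Q] p' := by
  obtain ⟨P₀, hP₀, -⟩ := h.finite
  -- Both densities are L¹-limits, in logarithm, along one and the same minimizing sequence.
  obtain ⟨u, -, hu, huC⟩ := exists_seq_tendsto_sInf (S := klDiv Q '' C)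
    ⟨_, P₀, hP₀, rfl⟩ (OrderBot.bddBelow _)
  choose P hP hPu using huC
  rw [sInf_image] at hu
  obtain rfl : (fun k => klDiv Q (P k)) = u := funext hPu
  have hsum := (h.tendsto P hP hu).add (h'.tendsto P hP hu)
  rw [add_zero] at hsum
  have hm : ∀ k, Measurable fun x => Real.log ((P k).rnDeriv ν x).toReal := fun k =>
    Real.measurable_log.comp (Measure.measurable_rnDeriv _ _).ennreal_toReal
  have hmp : Measurable fun x => Real.log (p x).toReal :=
    Real.measurable_log.comp h.measurable.ennreal_toReal
  have hmp' : Measurable fun x => Real.log (p' x).toReal :=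
    Real.measurable_log.comp h'.measurable.ennreal_toReal
  have hzero : ∫⁻ x, ‖Real.log (p x).toReal - Real.log (p' x).toReal‖ₑ ∂Q = 0 := by
    refine le_antisymm (ge_of_tendsto' hsum fun k => ?_) zero_le
    refine le_of_le_of_eq ?_ (lintegral_add_left ((hm k).sub hmp).enorm _)
    refine lintegral_mono fun x => ?_
    simp only [Pi.sub_apply]
    rw [← edist_eq_enorm_sub, ← edist_eq_enorm_sub, ← edist_eq_enorm_sub,
      edist_comm (Real.log ((P k).rnDeriv ν x).toReal)]
    exact edist_triangle _ _ _
  have hzero := (lintegral_eq_zero_iff (hmp.sub hmp').enorm).1 hzero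
  -- Equality of the real logarithms determines the densities only away from 0 and ∞, where `toReal`
  -- and `Real.log` take default values.
  have hft := hQν.ae_le (ae_lt_top h.measurable
    (ne_top_of_le_ne_top ENNReal.one_ne_top h.lintegral_le_one))
  have hft' := hQν.ae_le (ae_lt_top h'.measurable
    (ne_top_of_le_ne_top ENNReal.one_ne_top h'.lintegral_le_one))
  filter_upwards [hzero, hft, hft', h.pos, h'.pos] with x hx ht ht' h0 h0'
  have e : Real.log (p x).toReal = Real.log (p' x).toReal := by
    simpa [sub_eq_zero] using hx
  have := Real.log_injOn_pos (Set.mem_Ioi.2 (ENNReal.toReal_pos h0 ht.ne))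
    (Set.mem_Ioi.2 (ENNReal.toReal_pos h0' ht'.ne)) e
  exact (ENNReal.toReal_eq_toReal_iff' ht.ne ht'.ne).1 this

end General

/-! ### Convex hulls and approximation of continuous mixtures -/

section Mixtures

/-- Measures form only an `ℝ≥0`-module, so points are merged one at a time. Unnormalized weights
keep the induction hypothesis applicable to the remaining sum. -/
theorem exists_mem_sum_smul_eq {E ι : Type*} [AddCommMonoid E] [Module ℝ≥0 E] {s : Set E}
    (hs : Convex ℝ≥0 s) (w : ι → ℝ≥0) (z : ι → E) (t : Finset ι) (hz : ∀ i ∈ t, z i ∈ s)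
    (hw : ∑ i ∈ t, w i ≠ 0) : ∃ y ∈ s, ∑ i ∈ t, w i • z i = (∑ i ∈ t, w i) • y := by
  classical
  induction t using Finset.induction_on with
  | empty => simp at hw
  | insert i t hi ih =>
    have hzi := hz i (Finset.mem_insert_self _ _)
    rw [Finset.sum_insert hi] at hw
    simp only [Finset.sum_insert hi]
    rcases eq_or_ne (∑ j ∈ t, w j) 0 with h0 | h0
    · refine ⟨z i, hzi, ?_⟩
      have : ∑ j ∈ t, w j • z j = 0 := Finset.sum_eq_zero fun j hj => by
        rw [Finset.sum_eq_zero_iff.1 h0 j hj, zero_smul]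
      rw [h0, this, add_zero, add_zero]
    · obtain ⟨y, hy, hy'⟩ := ih (fun j hj => hz j (Finset.mem_insert_of_mem hj)) h0
      set c := ∑ j ∈ t, w j
      refine ⟨(w i / (w i + c)) • z i + (c / (w i + c)) • y,
        hs hzi hy zero_le zero_le ?_, ?_⟩
      · rw [← add_div, div_self hw]
      · rw [hy', smul_add, smul_smul, smul_smul, mul_div_cancel₀ _ hw, mul_div_cancel₀ _ hw]

variable {Ω : Type*} [MeasurableSpace Ω]

theorem withDensity_finsetSum {ι : Type*} (ν : Measure Ω) (t : Finset ι) {f : ι → Ω → ℝ≥0∞}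
    (hf : ∀ i, Measurable (f i)) :
    ν.withDensity (fun u => ∑ i ∈ t, f i u) = ∑ i ∈ t, ν.withDensity (f i) := by
  ext s hs
  rw [withDensity_apply _ hs, lintegral_finsetSum _ fun i _ => hf i, Measure.finsetSum_apply]
  exact Finset.sum_congr rfl fun i _ => (withDensity_apply _ hs).symm

/-- The three conditions define a convex set of measures. This carries the e-variable property of q
/ p from the null hypothesis to its finite mixtures. -/
theorem mem_convexHull_of_forall_lintegral_le_one {ν : Measure Ω} {H₀ : Set (Measure Ω)}
    {S : Ω → ℝ≥0∞} (h : ∀ P ∈ H₀, IsProbabilityMeasure P ∧ P ≪ ν ∧ ∫⁻ x, S x ∂P ≤ 1) :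
    ∀ P ∈ convexHull ℝ≥0 H₀, IsProbabilityMeasure P ∧ P ≪ ν ∧ ∫⁻ x, S x ∂P ≤ 1 := by
  refine convexHull_min
    (t := {P : Measure Ω | IsProbabilityMeasure P ∧ P ≪ ν ∧ ∫⁻ x, S x ∂P ≤ 1}) h ?_
  rintro P ⟨h1, h2, h3⟩ P' ⟨h1', h2', h3'⟩ a b - - hab
  have hab' : (a : ℝ≥0∞) + b = 1 := by exact_mod_cast hab
  refine ⟨⟨?_⟩, ?_, ?_⟩
  · simp only [Measure.add_apply, Measure.smul_apply, measure_univ, ENNReal.smul_def, smul_eq_mul,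
      mul_one]
    exact hab'
  · exact (h2.smul_left a).add_left (h2'.smul_left b)
  · rw [lintegral_add_measure, lintegral_smul_measure, lintegral_smul_measure]
    simp only [ENNReal.smul_def, smul_eq_mul]
    calc (a : ℝ≥0∞) * ∫⁻ x, S x ∂P + b * ∫⁻ x, S x ∂P' ≤ a * 1 + b * 1 := by gcongr
      _ = 1 := by rw [mul_one, mul_one, hab']

/-- The divergence of distributions with positive densities. -/
theorem klDiv_withDensity_ofReal_exp {ν Q P : Measure Ω} [SigmaFinite ν] [IsProbabilityMeasure Q]
    [IsProbabilityMeasure P] {lq lp : Ω → ℝ} (hlq : Measurable lq) (hlp : Measurable lp)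
    (hQ : Q = ν.withDensity fun x => ENNReal.ofReal (Real.exp (lq x)))
    (hP : P = ν.withDensity fun x => ENNReal.ofReal (Real.exp (lp x)))
    (hqi : Integrable lq Q) (hpi : Integrable lp Q) :
    klDiv Q P ≠ ∞ ∧ (klDiv Q P).toReal = ∫ x, lq x ∂Q - ∫ x, lp x ∂Q := by
  have hmq : Measurable fun x => ENNReal.ofReal (Real.exp (lq x)) := by fun_prop
  have hmp : Measurable fun x => ENNReal.ofReal (Real.exp (lp x)) := by fun_prop
  have hQν : Q ≪ ν := hQ ▸ withDensity_absolutelyContinuous _ _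
  have hνP : ν ≪ P := hP ▸ withDensity_absolutelyContinuous' hmp.aemeasurable
    (ae_of_all _ fun x => by simp [Real.exp_pos])
  have hac := hQν.trans hνP
  have hllr : llr Q P =ᵐ[Q] fun x => lq x - lp x := by
    have h1 := hQν.ae_le (Measure.rnDeriv_mul_rnDeriv (κ := ν) hac)
    have h2 := Measure.rnDeriv_withDensity ν hmq
    have h3 := Measure.rnDeriv_withDensity ν hmp
    rw [← hQ] at h2
    rw [← hP] at h3
    filter_upwards [h1, hQν.ae_le h2, hQν.ae_le h3] with x e1 e2 e3
    rw [Pi.mul_apply, e2, e3] at e1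
    have e4 : (Q.rnDeriv P x).toReal * Real.exp (lp x) = Real.exp (lq x) := by
      have := congrArg ENNReal.toReal e1
      rwa [ENNReal.toReal_mul, ENNReal.toReal_ofReal (Real.exp_pos _).le,
        ENNReal.toReal_ofReal (Real.exp_pos _).le] at this
    rw [llr, eq_div_of_mul_eq (Real.exp_pos _).ne' e4, ← Real.exp_sub, Real.log_exp]
  have hi : Integrable (llr Q P) Q := (hqi.sub hpi).congr hllr.symm
  refine ⟨klDiv_ne_top hac hi, ?_⟩
  rw [toReal_klDiv_of_measure_eq hac (by simp), integral_congr_ae hllr, integral_sub hqi hpi]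

variable {Θ : Type*} [MeasurableSpace Θ]

/-- The image of the prior under a simple function has finite support, so the mixture is a finite
convex combination. -/
theorem withDensity_lintegral_simpleFunc_mem_convexHull {ν : Measure Ω} {f : Θ → Ω → ℝ≥0∞}
    (hf : ∀ m, Measurable (f m)) (W : Measure Θ) [IsProbabilityMeasure W] (φ : SimpleFunc Θ Θ) :
    ν.withDensity (fun u => ∫⁻ m, f (φ m) u ∂W)
      ∈ convexHull ℝ≥0 (Set.range fun m => ν.withDensity (f m)) := by
  have hsum : ∀ g : Θ → ℝ≥0∞, ∫⁻ m, g (φ m) ∂W = ∑ x ∈ φ.range, g x * W (φ ⁻¹' {x}) := by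
    intro g
    rw [← SimpleFunc.map_lintegral, ← SimpleFunc.lintegral_eq_lintegral]
    rfl
  have hw : ∑ x ∈ φ.range, (W (φ ⁻¹' {x})).toNNReal = 1 := by
    have := hsum fun _ => 1
    simp only [lintegral_const, measure_univ, one_mul] at this
    rw [← ENNReal.coe_inj, ENNReal.ofNNReal_finsetSum, ENNReal.coe_one, this]
    exact Finset.sum_congr rfl fun x _ => ENNReal.coe_toNNReal (measure_ne_top _ _)
  have heq : ν.withDensity (fun u => ∫⁻ m, f (φ m) u ∂W)
      = ∑ x ∈ φ.range, (W (φ ⁻¹' {x})).toNNReal • ν.withDensity (f x) := by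
    have : (fun u => ∫⁻ m, f (φ m) u ∂W)
        = fun u => ∑ x ∈ φ.range, (W (φ ⁻¹' {x}) • f x) u := by
      ext u
      rw [hsum fun m => f m u]
      exact Finset.sum_congr rfl fun x _ => by rw [Pi.smul_apply, smul_eq_mul, mul_comm]
    rw [this, withDensity_finsetSum _ _ fun x => (hf x).const_smul _]
    refine Finset.sum_congr rfl fun x _ => ?_
    rw [withDensity_smul _ (hf x), ENNReal.smul_def, ENNReal.coe_toNNReal (measure_ne_top _ _)]
  obtain ⟨y, hy, hy'⟩ := exists_mem_sum_smul_eq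
    (convex_convexHull ℝ≥0 (Set.range fun m => ν.withDensity (f m)))
    (fun x => (W (φ ⁻¹' {x})).toNNReal) (fun x => ν.withDensity (f x)) φ.range
    (fun x _ => subset_convexHull ℝ≥0 _ (Set.mem_range_self x)) (by rw [hw]; exact one_ne_zero)
  rw [heq, hy', hw, one_smul]
  exact hy

/-- Continuous mixtures are approximated in divergence by finite mixtures. -/
theorem exists_mem_convexHull_klDiv_le [MetricSpace Θ] [SecondCountableTopology Θ]
    [BorelSpace Θ] {ν Q : Measure Ω} [SigmaFinite ν] [IsProbabilityMeasure Q]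
    {lq lp : Ω → ℝ} (hlq : Measurable lq)
    (hQ : Q = ν.withDensity fun x => ENNReal.ofReal (Real.exp (lq x))) (hqi : Integrable lq Q)
    {l : Θ → Ω → ℝ} (hl : Measurable (Function.uncurry l)) (hlc : ∀ u, Continuous fun m => l m u)
    {c : ℝ} (hc : ∀ m u, l m u ≤ c)
    (hprob : ∀ m, IsProbabilityMeasure
      (ν.withDensity fun u => ENNReal.ofReal (Real.exp (l m u))))
    (m₀ : Θ) (hm₀ : Integrable (l m₀) Q) (W : Measure Θ) [IsProbabilityMeasure W]
    (hp : ∀ᵐ u ∂Q, ∫⁻ m, ENNReal.ofReal (Real.exp (l m u)) ∂W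
      = ENNReal.ofReal (Real.exp (lp u)))
    (hpi : Integrable lp Q) {ε : ℝ} (hε : 0 < ε) :
    ∃ P ∈ convexHull ℝ≥0
        (Set.range fun m => ν.withDensity fun u => ENNReal.ofReal (Real.exp (l m u))),
      klDiv Q P ≠ ∞ ∧ (klDiv Q P).toReal ≤ ∫ x, (lq x - lp x) ∂Q + ε := by
  -- A share b = 1 - a of the fixed member m₀ is mixed in: it bounds the log-densities below by log
  -- b + l m₀, which is integrable and independent of k. The share a left to the mixture costs at
  -- most -log a = ε / 2.
  set a : ℝ := Real.exp (-(ε / 2)) with ha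
  have ha0 : 0 < a := Real.exp_pos _
  have ha1 : a < 1 := by rw [ha, Real.exp_lt_one_iff]; linarith
  set b : ℝ := 1 - a with hb
  have hb0 : 0 < b := by rw [hb]; linarith
  -- Simple functions converging pointwise to the identity of the parameter space; by continuity of
  -- l in the parameter, the finite mixtures converge pointwise.
  let φ : ℕ → SimpleFunc Θ Θ := fun k =>
    SimpleFunc.approxOn id measurable_id Set.univ m₀ (Set.mem_univ _) k
  have hφ : ∀ m, Tendsto (fun k => φ k m) atTop (𝓝 m) := fun m =>
    SimpleFunc.tendsto_approxOn measurable_id (Set.mem_univ _) (by simp)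
  have hlm : ∀ m, Measurable (l m) := fun m => hl.comp (measurable_const.prodMk measurable_id)
  have hlk : ∀ k, Measurable (Function.uncurry fun m u => l (φ k m) u) := fun k =>
    hl.comp (((φ k).measurable.comp measurable_fst).prodMk measurable_snd)
  let F : ℕ → Ω → ℝ := fun k u => ∫ m, Real.exp (l (φ k m) u) ∂W
  let F' : Ω → ℝ := fun u => ∫ m, Real.exp (l m u) ∂W
  have hint : ∀ (g : Θ → ℝ) (_ : Measurable g), (∀ m, g m ≤ c) →
      Integrable (fun m => Real.exp (g m)) W := fun g hg hgc =>
    Integrable.of_bound (Real.measurable_exp.comp hg).aestronglyMeasurable (Real.exp c)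
      (ae_of_all _ fun m => by
        rw [Real.norm_eq_abs, abs_of_pos (Real.exp_pos _)]; exact Real.exp_le_exp.2 (hgc m))
  have hFi : ∀ k u, Integrable (fun m => Real.exp (l (φ k m) u)) W := fun k u =>
    hint _ ((hlk k).comp (measurable_id.prodMk measurable_const)) fun m => hc _ _
  have hF'i : ∀ u, Integrable (fun m => Real.exp (l m u)) W := fun u =>
    hint _ (hl.comp (measurable_id.prodMk measurable_const)) fun m => hc _ _
  have hFm : ∀ k, Measurable (F k) := fun k =>
    (StronglyMeasurable.integral_prod_left'
      (f := fun x : Θ × Ω => Real.exp (l (φ k x.1) x.2))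
      (Real.measurable_exp.comp (hlk k)).stronglyMeasurable).measurable
  have hF0 : ∀ k u, 0 ≤ F k u := fun k u => integral_nonneg fun m => (Real.exp_pos _).le
  have hFc : ∀ k u, F k u ≤ Real.exp c := fun k u => by
    calc F k u ≤ ∫ _, Real.exp c ∂W :=
          integral_mono (hFi k u) (integrable_const _) fun m => Real.exp_le_exp.2 (hc _ _)
      _ = Real.exp c := by simp
  have hFlim : ∀ u, Tendsto (fun k => F k u) atTop (𝓝 (F' u)) := fun u =>
    tendsto_integral_of_dominated_convergence (fun _ => Real.exp c)
      (fun k => (hFi k u).aestronglyMeasurable) (integrable_const _)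
      (fun k => ae_of_all _ fun m => by
        rw [Real.norm_eq_abs, abs_of_pos (Real.exp_pos _)]; exact Real.exp_le_exp.2 (hc _ _))
      (ae_of_all _ fun m => (Real.continuous_exp.tendsto _).comp
        (((hlc u).tendsto m).comp (hφ m)))
  let r : ℕ → Ω → ℝ := fun k u => a * F k u + b * Real.exp (l m₀ u)
  let r' : Ω → ℝ := fun u => a * F' u + b * Real.exp (l m₀ u)
  have hbe : ∀ u, 0 < b * Real.exp (l m₀ u) := fun u => mul_pos hb0 (Real.exp_pos _)
  have hrlow : ∀ k u, b * Real.exp (l m₀ u) ≤ r k u := fun k u => by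
    have := mul_nonneg ha0.le (hF0 k u)
    simp only [r]; linarith
  have hrpos : ∀ k u, 0 < r k u := fun k u => (hbe u).trans_le (hrlow k u)
  have hr'pos : ∀ u, 0 < r' u := fun u => by
    have : 0 ≤ F' u := integral_nonneg fun m => (Real.exp_pos _).le
    have := mul_nonneg ha0.le this
    have := hbe u
    simp only [r']; linarith
  have hrup : ∀ k u, r k u ≤ Real.exp c := fun k u => by
    have h1 := mul_le_mul_of_nonneg_left (hFc k u) ha0.le
    have h2 := mul_le_mul_of_nonneg_left (Real.exp_le_exp.2 (hc m₀ u)) hb0.le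
    have h3 : a * Real.exp c + b * Real.exp c = Real.exp c := by rw [hb]; ring
    simp only [r]; linarith
  have hrm : ∀ k, Measurable (r k) := fun k =>
    ((hFm k).const_mul a).add ((Real.measurable_exp.comp (hlm m₀)).const_mul b)
  have hbound : ∀ k u, ‖Real.log (r k u)‖ ≤ |c| + (|Real.log b| + |l m₀ u|) := fun k u => by
    have h1 : Real.log (r k u) ≤ c := by
      rw [Real.log_le_iff_le_exp (hrpos k u)]; exact hrup k u
    have h2 : Real.log b + l m₀ u ≤ Real.log (r k u) := by
      have := Real.log_le_log (hbe u) (hrlow k u)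
      rwa [Real.log_mul hb0.ne' (Real.exp_pos _).ne', Real.log_exp] at this
    rw [Real.norm_eq_abs, abs_le]
    constructor
    · linarith [neg_abs_le (Real.log b), neg_abs_le (l m₀ u), abs_nonneg c]
    · linarith [le_abs_self c, abs_nonneg (Real.log b), abs_nonneg (l m₀ u)]
  have hboundi : Integrable (fun u => |c| + (|Real.log b| + |l m₀ u|)) Q :=
    (integrable_const _).add ((integrable_const _).add hm₀.abs)
  have hlogm : ∀ k, Measurable fun u => Real.log (r k u) := fun k =>
    Real.measurable_log.comp (hrm k)
  have hlogi : ∀ k, Integrable (fun u => Real.log (r k u)) Q := fun k =>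
    hboundi.mono' (hlogm k).aestronglyMeasurable (ae_of_all _ (hbound k))
  have hloglim : ∀ u, Tendsto (fun k => Real.log (r k u)) atTop (𝓝 (Real.log (r' u))) := fun u =>
    (Real.continuousAt_log (hr'pos u).ne').tendsto.comp
      (((hFlim u).const_mul a).add tendsto_const_nhds)
  have hlim : Tendsto (fun k => ∫ u, Real.log (r k u) ∂Q) atTop (𝓝 (∫ u, Real.log (r' u) ∂Q)) :=
    tendsto_integral_of_dominated_convergence _ (fun k => (hlogm k).aestronglyMeasurable)
      hboundi (fun k => ae_of_all _ (hbound k)) (ae_of_all _ hloglim)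
  have hr'i : Integrable (fun u => Real.log (r' u)) Q :=
    hboundi.mono' (aestronglyMeasurable_of_tendsto_ae atTop
      (fun k => (hlogm k).aestronglyMeasurable) (ae_of_all _ hloglim))
      (ae_of_all _ fun u => le_of_tendsto (hloglim u).norm (Eventually.of_forall fun k =>
        hbound k u))
  -- Dropping the m₀ term from r' leaves a · exp lp, with logarithm lp - ε / 2.
  have hr'ge : ∫ u, lp u ∂Q - ε / 2 ≤ ∫ u, Real.log (r' u) ∂Q := by
    have h1 : ∫ u, lp u ∂Q - ε / 2 = ∫ u, (lp u - ε / 2) ∂Q := by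
      rw [integral_sub hpi (integrable_const _)]; simp
    rw [h1]
    refine integral_mono_ae (hpi.sub (integrable_const _)) hr'i ?_
    filter_upwards [hp] with u hu
    have h2 : F' u = Real.exp (lp u) := by
      simp only [F']
      rw [integral_eq_lintegral_of_nonneg_ae (ae_of_all _ fun m => (Real.exp_pos _).le)
        (hF'i u).aestronglyMeasurable, hu, ENNReal.toReal_ofReal (Real.exp_pos _).le]
    show lp u - ε / 2 ≤ Real.log (r' u)
    rw [Real.le_log_iff_exp_le (hr'pos u), sub_eq_add_neg, Real.exp_add, ← ha, ← h2, mul_comm]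
    have := hbe u
    simp only [r']; linarith
  obtain ⟨k, hk⟩ := (hlim.eventually (lt_mem_nhds (by linarith :
    ∫ u, lp u ∂Q - ε < ∫ u, Real.log (r' u) ∂Q))).exists
  let f : Θ → Ω → ℝ≥0∞ := fun m u => ENNReal.ofReal (Real.exp (l m u))
  have hfm : ∀ m, Measurable (f m) := fun m =>
    ENNReal.measurable_ofReal.comp (Real.measurable_exp.comp (hlm m))
  have hmem := withDensity_lintegral_simpleFunc_mem_convexHull (ν := ν) hfm W (φ k)
  have hmem₀ : ν.withDensity (f m₀) ∈ convexHull ℝ≥0 (Set.range fun m => ν.withDensity (f m)) :=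
    subset_convexHull _ _ ⟨m₀, rfl⟩
  have hFeq : ∀ u, ∫⁻ m, f (φ k m) u ∂W = ENNReal.ofReal (F k u) := fun u =>
    (ofReal_integral_eq_lintegral_ofReal (hFi k u)
      (ae_of_all _ fun m => (Real.exp_pos _).le)).symm
  have hP : a.toNNReal • ν.withDensity (fun u => ∫⁻ m, f (φ k m) u ∂W)
      + b.toNNReal • ν.withDensity (f m₀)
      = ν.withDensity fun u => ENNReal.ofReal (Real.exp (Real.log (r k u))) := by
    have e : (fun u => ENNReal.ofReal (Real.exp (Real.log (r k u))))
        = (a.toNNReal : ℝ≥0∞) • (fun u => ∫⁻ m, f (φ k m) u ∂W) + (b.toNNReal : ℝ≥0∞) • f m₀ := by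
      ext u
      rw [Real.exp_log (hrpos k u), Pi.add_apply, Pi.smul_apply, Pi.smul_apply, hFeq u]
      simp only [r, f, smul_eq_mul]
      rw [ENNReal.ofReal_add (mul_nonneg ha0.le (hF0 k u)) (hbe u).le,
        ENNReal.ofReal_mul ha0.le, ENNReal.ofReal_mul hb0.le]
      rfl
    have hm1 : Measurable fun u => ∫⁻ m, f (φ k m) u ∂W := by
      simp_rw [hFeq]; exact ENNReal.measurable_ofReal.comp (hFm k)
    rw [e, withDensity_add_left (hm1.const_smul _), withDensity_smul _ hm1,
      withDensity_smul _ (hfm m₀)]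
    rfl
  have hab : a.toNNReal + b.toNNReal = 1 := by
    rw [← Real.toNNReal_add ha0.le hb0.le, hb]; simp
  have hPmem := (convex_convexHull ℝ≥0 _) hmem hmem₀ zero_le zero_le hab
  -- Taking S = 0 makes the integral condition void; only the total mass is wanted here.
  have hPprob := (mem_convexHull_of_forall_lintegral_le_one (ν := ν) (S := fun _ => 0) (by
    rintro _ ⟨m, rfl⟩
    exact ⟨hprob m, withDensity_absolutelyContinuous _ _, by simp⟩) _ hPmem).1
  have hkl := klDiv_withDensity_ofReal_exp hlq (hlogm k) hQ hP hqi (hlogi k)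
  refine ⟨_, hPmem, hkl.1, ?_⟩
  rw [hkl.2, integral_sub hqi hpi]
  linarith

end Mixtures

/-! ### Conditional distributions given a statistic -/

section Cond

variable {Ω T : Type*} [MeasurableSpace Ω] [MeasurableSpace T]

theorem map_withDensity_comp {P : Measure Ω} {Z : Ω → T} (hZ : Measurable Z) {h : T → ℝ≥0∞}
    (hh : Measurable h) :
    (P.withDensity fun u => h (Z u)).map Z = (P.map Z).withDensity h := by
  ext s hs
  rw [Measure.map_apply hZ hs, withDensity_apply _ (hZ hs), withDensity_apply _ hs,
    setLIntegral_map hs hh hZ]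

theorem withDensity_compProd {π : Measure T} [SFinite π] {κ : Kernel T Ω} [IsSFiniteKernel κ]
    {h : T → ℝ≥0∞} (hh : Measurable h) [SFinite (π.withDensity h)] :
    π.withDensity h ⊗ₘ κ = (π ⊗ₘ κ).withDensity fun x => h x.1 := by
  have hh1 : Measurable fun x : T × Ω => h x.1 := hh.comp measurable_fst
  ext s hs
  rw [Measure.compProd_apply hs, withDensity_apply _ hs, ← lintegral_indicator hs,
    Measure.lintegral_compProd (hh1.indicator hs),
    lintegral_withDensity_mul hh (Kernel.measurable_kernel_prodMk_left hs)]
  refine lintegral_congr fun a => ?_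
  have : ∀ b, s.indicator (fun x : T × Ω => h x.1) (a, b)
      = h a * (Prod.mk a ⁻¹' s).indicator (fun _ => 1) b := fun b => by
    by_cases hb : (a, b) ∈ s <;> simp [Set.indicator, hb]
  simp_rw [this]
  rw [lintegral_const_mul _ (measurable_const.indicator (measurable_prodMk_left hs)),
    lintegral_indicator (measurable_prodMk_left hs)]
  simp

/-- Sufficiency: a change of density through the statistic does not alter the conditional
distributions given the statistic. -/
theorem IsRegularCondDistrib.withDensity_comp {P : Measure Ω} [IsProbabilityMeasure P]
    {Z : Ω → T} (hZ : Measurable Z) {κ : Kernel T Ω} (hκ : IsRegularCondDistrib P Z κ)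
    {h : T → ℝ≥0∞} (hh : Measurable h) :
    IsRegularCondDistrib (P.withDensity fun u => h (Z u)) Z κ := by
  obtain ⟨hM, he⟩ := hκ
  refine ⟨hM, ?_⟩
  have := Measure.isProbabilityMeasure_map hZ.aemeasurable (μ := P)
  rw [map_withDensity_comp hZ hh, withDensity_compProd hh, he]
  exact (map_withDensity_comp (P := P) (hZ.prodMk measurable_id) (hh.comp measurable_fst)).symm

theorem isRegularCondDistrib_condDistrib [StandardBorelSpace Ω] [Nonempty Ω] {P : Measure Ω}
    [IsProbabilityMeasure P] (Z : Ω → T) :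
    IsRegularCondDistrib P Z (condDistrib id Z P) :=
  ⟨inferInstance, compProd_map_condDistrib aemeasurable_id⟩

/-- A conditional e-variable exists if all elements of the null hypothesis have densities that
depend on the statistic only, relative to a fixed one. -/
theorem exists_isCondEVariable [StandardBorelSpace Ω] [Nonempty Ω]
    [MeasurableSpace.CountableOrCountablyGenerated T Ω]
    {H₀ : Set (Measure Ω)} {P Q : Measure Ω} [IsProbabilityMeasure P] [IsProbabilityMeasure Q]
    {Z : Ω → T} (hZ : Measurable Z)
    (hH : ∀ P' ∈ H₀, ∃ h : T → ℝ≥0∞, Measurable h ∧ P' = P.withDensity fun u => h (Z u)) :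
    ∃ S, IsCondEVariable H₀ Q Z S := by
  set κP := condDistrib id Z P
  set κQ := condDistrib id Z Q
  -- The sum of the two kernels dominates both, so densities relative to it exist for every z and
  -- not only for almost every z.
  refine ⟨_, κP, κQ, κP + κQ, κP.rnDeriv (κP + κQ), κQ.rnDeriv (κP + κQ), ?_,
    isRegularCondDistrib_condDistrib Z, Kernel.measurable_rnDeriv _ _,
    Kernel.measurable_rnDeriv _ _, fun z => ?_, fun z => ?_, rfl⟩
  · intro P' hP'
    obtain ⟨h, hh, rfl⟩ := hH P' hP'
    exact (isRegularCondDistrib_condDistrib Z).withDensity_comp hZ hh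
  · have hac : κP z ≪ (κP + κQ) z := by
      rw [_root_.add_apply]; exact Measure.absolutelyContinuous_of_le (Measure.le_add_right le_rfl)
    rw [← Kernel.withDensity_apply _ (Kernel.measurable_rnDeriv _ _),
      Kernel.withDensity_rnDeriv_eq hac]
  · have hac : κQ z ≪ (κP + κQ) z := by
      rw [_root_.add_apply]; exact Measure.absolutelyContinuous_of_le (Measure.le_add_left le_rfl)
    rw [← Kernel.withDensity_apply _ (Kernel.measurable_rnDeriv _ _),
      Kernel.withDensity_rnDeriv_eq hac]

/-- Conditional e-variables are quotients of likelihood ratios. -/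
theorem IsCondEVariable.ae_eq [MeasurableSpace.CountableOrCountablyGenerated T Ω]
    {H₀ : Set (Measure Ω)} {P Q : Measure Ω} [IsProbabilityMeasure P] [IsProbabilityMeasure Q]
    {Z : Ω → T} (hZ : Measurable Z) (hP : P ∈ H₀) {f : Ω → ℝ≥0∞} {g : T → ℝ≥0∞}
    (hf : Measurable f) (hg : Measurable g) (hg0 : ∀ z, g z ≠ 0) (hgt : ∀ z, g z ≠ ∞)
    (hQ : Q = P.withDensity f) (hQZ : Q.map Z = (P.map Z).withDensity g) {S : Ω → ℝ≥0∞}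
    (hS : IsCondEVariable H₀ Q Z S) : S =ᵐ[P] fun u => f u / g (Z u) := by
  obtain ⟨κP, κQ, ν', p, q, hκP, ⟨hMQ, heQ⟩, hpm, hqm, hp, hq, rfl⟩ := hS
  obtain ⟨hMP, heP⟩ := hκP P hP
  have hπ := Measure.isProbabilityMeasure_map hZ.aemeasurable (μ := P)
  have hπQ := Measure.isProbabilityMeasure_map hZ.aemeasurable (μ := Q)
  have hpair : Measurable fun u => (Z u, u) := hZ.prodMk measurable_id
  set π := P.map Z
  have hSF : SFinite (π.withDensity g) := hQZ ▸ inferInstance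
  have hQf : Q.map (fun u => (Z u, u)) = (π ⊗ₘ κP).withDensity fun x => f x.2 := by
    rw [heP, hQ]
    exact map_withDensity_comp (P := P) hpair (hf.comp measurable_snd)
  have hQg : Q.map (fun u => (Z u, u)) = (π ⊗ₘ κQ).withDensity fun x => g x.1 := by
    rw [← heQ, hQZ, withDensity_compProd hg]
  -- As g does not vanish, π ⊗ κQ is dominated by the joint law of (Z, u) under Q, which has a
  -- density relative to π ⊗ κP.
  have hac : ∀ᵐ z ∂π, κQ z ≪ κP z := by
    rw [← Measure.absolutelyContinuous_compProd_right_iff]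
    have h1 : π ⊗ₘ κQ ≪ (π ⊗ₘ κQ).withDensity fun x => g x.1 :=
      withDensity_absolutelyContinuous' (hg.comp measurable_fst).aemeasurable
        (ae_of_all _ fun x => hg0 _)
    rw [← hQg, hQf] at h1
    exact h1.trans (withDensity_absolutelyContinuous _ _)
  have hrn : ∀ᵐ z ∂π, κQ z = κP.withDensity (κQ.rnDeriv κP) z := by
    filter_upwards [hac] with z hz using (Kernel.withDensity_rnDeriv_eq hz).symm
  have hcomp : π ⊗ₘ κQ = (π ⊗ₘ κP).withDensity fun x => κQ.rnDeriv κP x.1 x.2 := by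
    rw [Measure.compProd_congr hrn,
      Measure.compProd_withDensity (Kernel.measurable_rnDeriv _ _)]
  -- Two densities of the joint law under Q relative to π ⊗ κP: one by disintegration, one directly
  -- from f. The law is finite, so they agree almost everywhere.
  have hden : (fun x : T × Ω => κQ.rnDeriv κP x.1 x.2 * g x.1) =ᵐ[π ⊗ₘ κP] fun x => f x.2 := by
    have hm1 : Measurable fun x : T × Ω => κQ.rnDeriv κP x.1 x.2 :=
      Kernel.measurable_rnDeriv _ _
    have hm2 : Measurable fun x : T × Ω => g x.1 := hg.comp measurable_fst
    have h1 : (π ⊗ₘ κP).withDensity (fun x => κQ.rnDeriv κP x.1 x.2 * g x.1)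
        = (π ⊗ₘ κP).withDensity fun x => f x.2 := by
      rw [← hQf, hQg, hcomp]
      exact withDensity_mul _ hm1 hm2
    refine (withDensity_eq_iff (hm1.mul hm2).aemeasurable
      (hf.comp measurable_snd).aemeasurable ?_).1 h1
    have h2 : ∫⁻ x : T × Ω, κQ.rnDeriv κP x.1 x.2 * g x.1 ∂(π ⊗ₘ κP)
        = Q.map (fun u => (Z u, u)) Set.univ := by
      rw [hQf, ← h1, withDensity_apply _ MeasurableSet.univ, Measure.restrict_univ]
    refine h2.trans_ne ?_
    have := Measure.isProbabilityMeasure_map hpair.aemeasurable (μ := Q)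
    exact measure_ne_top _ _
  -- The quotient of the densities does not depend on the dominating measure ν': it is the
  -- derivative of κQ relative to κP.
  have hquot : ∀ᵐ z ∂π, ∀ᵐ u ∂(κP z), q z u / p z u = κQ.rnDeriv κP z u := by
    filter_upwards [hrn] with z hz
    have hpz : Measurable (p z) := hpm.comp measurable_prodMk_left
    have hqz : Measurable (q z) := hqm.comp measurable_prodMk_left
    have hrz : Measurable (κQ.rnDeriv κP z) :=
      (Kernel.measurable_rnDeriv κQ κP).comp measurable_prodMk_left
    rw [Kernel.withDensity_apply _ (Kernel.measurable_rnDeriv _ _), hp z,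
      ← withDensity_mul _ hpz hrz, hq z] at hz
    have hqi : ∫⁻ u, q z u ∂(ν' z) ≠ ∞ := by
      rw [← setLIntegral_univ, ← withDensity_apply _ MeasurableSet.univ, ← hq z]
      exact measure_ne_top _ _
    have hpi : ∫⁻ u, p z u ∂(ν' z) ≠ ∞ := by
      rw [← setLIntegral_univ, ← withDensity_apply _ MeasurableSet.univ, ← hp z]
      exact measure_ne_top _ _
    have hqp := (withDensity_eq_iff hqz.aemeasurable (hpz.mul hrz).aemeasurable hqi).1 hz
    rw [hp z, ae_withDensity_iff hpz]
    filter_upwards [hqp, ae_lt_top hpz hpi] with u hu hpt hp0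
    rw [hu, Pi.mul_apply, mul_comm, ENNReal.mul_div_cancel_right hp0 hpt.ne]
  have hquot' : ∀ᵐ x ∂(π ⊗ₘ κP), q x.1 x.2 / p x.1 x.2 = κQ.rnDeriv κP x.1 x.2 := by
    refine (Measure.ae_compProd_iff (measurableSet_eq_fun (hqm.div hpm)
      (Kernel.measurable_rnDeriv κQ κP))).2 hquot
  have hfin : ∀ᵐ x ∂(π ⊗ₘ κP), q x.1 x.2 / p x.1 x.2 = f x.2 / g x.1 := by
    filter_upwards [hquot', hden] with x h1 h2
    rw [h1, ← h2, ENNReal.mul_div_cancel_right (hg0 _) (hgt _)]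
  rw [heP] at hfin
  exact ae_of_ae_map hpair.aemeasurable hfin

/-- The quotient of likelihood ratios of the data and of the statistic has expectation at most one
under all changes of density through the statistic. -/
theorem lintegral_div_comp_le_one {P Q : Measure Ω} {Z : Ω → T} (hZ : Measurable Z)
    {f : Ω → ℝ≥0∞} {g h : T → ℝ≥0∞} (hf : Measurable f) (hg : Measurable g) (hh : Measurable h)
    (hQ : Q = P.withDensity f) (hQZ : Q.map Z = (P.map Z).withDensity g)
    [IsProbabilityMeasure (P.withDensity fun u => h (Z u))] :
    ∫⁻ u, f u / g (Z u) ∂(P.withDensity fun u => h (Z u)) ≤ 1 := by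
  have hhZ : Measurable fun u => h (Z u) := hh.comp hZ
  have hgZ : Measurable fun u => g (Z u) := hg.comp hZ
  calc ∫⁻ u, f u / g (Z u) ∂(P.withDensity fun u => h (Z u))
      = ∫⁻ u, h (Z u) * (f u / g (Z u)) ∂P := lintegral_withDensity_mul hhZ (hf.div hgZ)
    _ = ∫⁻ u, f u * (h (Z u) / g (Z u)) ∂P := by
        refine lintegral_congr fun u => ?_
        simp only [div_eq_mul_inv]; ring
    _ = ∫⁻ u, h (Z u) / g (Z u) ∂Q := by
        rw [hQ]; exact (lintegral_withDensity_mul hf (hhZ.div hgZ)).symm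
    _ = ∫⁻ z, h z / g z ∂(Q.map Z) := (lintegral_map (hh.div hg) hZ).symm
    _ = ∫⁻ z, g z * (h z / g z) ∂(P.map Z) := by
        rw [hQZ]; exact lintegral_withDensity_mul hg (hh.div hg)
    -- Equality may fail where g is 0 or ∞.
    _ ≤ ∫⁻ z, h z ∂(P.map Z) := lintegral_mono fun z => ENNReal.mul_div_le
    _ = ∫⁻ u, h (Z u) ∂P := lintegral_map hh hZ
    _ = 1 := by
        rw [← setLIntegral_univ, ← withDensity_apply _ MeasurableSet.univ, measure_univ]

end Cond

/-! ### Densities of product measures -/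

section PiDensity

variable {E : Type*} [MeasurableSpace E]

theorem lintegral_fin_prod_eq_prod {n : ℕ} {μ : Fin n → Measure E} [∀ i, SigmaFinite (μ i)]
    {f : Fin n → E → ℝ≥0∞} (hf : ∀ i, Measurable (f i)) :
    ∫⁻ x, ∏ i, f i (x i) ∂(Measure.pi μ) = ∏ i, ∫⁻ x, f i x ∂(μ i) := by
  induction n with
  | zero => simp
  | succ n ih =>
    have hm : Measurable fun x : Fin n → E => ∏ i : Fin n, f (Fin.succ i) (x i) :=
      Finset.measurable_prod _ fun i _ => (hf _).comp (measurable_pi_apply i)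
    calc ∫⁻ x, ∏ i, f i (x i) ∂(Measure.pi μ)
        = ∫⁻ x : E × (Fin n → E), f 0 x.1 * ∏ i : Fin n, f (Fin.succ i) (x.2 i)
            ∂((μ 0).prod (Measure.pi (fun i => μ i.succ))) := by
          rw [← ((measurePreserving_piFinSuccAbove μ 0).symm).lintegral_comp_emb
            (MeasurableEquiv.measurableEmbedding _)]
          simp_rw [MeasurableEquiv.piFinSuccAbove_symm_apply, Fin.insertNthEquiv,
            Fin.prod_univ_succ, Fin.insertNth_zero, Equiv.coe_fn_mk, Fin.cons_succ,
            Fin.zero_succAbove, Fin.cons_zero]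
          rfl
      _ = (∫⁻ x, f 0 x ∂μ 0) * ∏ i : Fin n, ∫⁻ x, f (Fin.succ i) x ∂(μ i.succ) := by
          rw [← ih fun i => hf _]
          exact lintegral_prod_mul (hf 0).aemeasurable hm.aemeasurable
      _ = ∏ i, ∫⁻ x, f i x ∂(μ i) := by rw [Fin.prod_univ_succ]

theorem pi_withDensity {n : ℕ} {ν : Measure E} [SigmaFinite ν] {f : E → ℝ≥0∞}
    (hf : Measurable f) [SigmaFinite (ν.withDensity f)] :
    Measure.pi (fun _ : Fin n => ν.withDensity f)
      = (Measure.pi fun _ => ν).withDensity fun x => ∏ i, f (x i) := by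
  refine (Measure.pi_eq fun s hs => ?_)
  rw [withDensity_apply _ (MeasurableSet.univ_pi hs), Measure.restrict_pi_pi,
    lintegral_fin_prod_eq_prod fun _ => hf]
  exact Finset.prod_congr rfl fun i _ => (withDensity_apply _ (hs i)).symm

end PiDensity

/-! ### Densities of Gaussian distributions -/

section Gauss

variable {d : ℕ}

/-- The quadratic form `vᵀ A v`. -/
noncomputable def quad (A : Matrix (Fin d) (Fin d) ℝ) (v : EuclideanSpace ℝ (Fin d)) : ℝ :=
  v.ofLp ⬝ᵥ (A *ᵥ v.ofLp)

/-- Logarithm of the Gaussian density. -/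
noncomputable def logDensity (m : EuclideanSpace ℝ (Fin d)) (S : Matrix (Fin d) (Fin d) ℝ)
    (x : EuclideanSpace ℝ (Fin d)) : ℝ :=
  -(1 / 2) * Real.log ((2 * Real.pi) ^ d * S.det) - 1 / 2 * quad S⁻¹ (x - m)

/-- Logarithm of the Gaussian density of `n` independent outcomes. -/
noncomputable def logDensityN (m : EuclideanSpace ℝ (Fin d)) (S : Matrix (Fin d) (Fin d) ℝ) (n : ℕ)
    (u : Fin n → EuclideanSpace ℝ (Fin d)) : ℝ :=
  ∑ i, logDensity m S (u i)

@[fun_prop]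
theorem continuous_quad (A : Matrix (Fin d) (Fin d) ℝ) : Continuous (quad A) := by
  unfold quad
  simp only [dotProduct, mulVec]
  fun_prop

theorem continuous_logDensity_uncurry (S : Matrix (Fin d) (Fin d) ℝ) :
    Continuous fun x : EuclideanSpace ℝ (Fin d) × EuclideanSpace ℝ (Fin d) =>
      logDensity x.1 S x.2 := by
  unfold logDensity
  fun_prop

@[fun_prop]
theorem continuous_logDensity (m : EuclideanSpace ℝ (Fin d)) (S : Matrix (Fin d) (Fin d) ℝ) :
    Continuous (logDensity m S) := by
  unfold logDensity
  fun_prop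

@[fun_prop]
theorem measurable_logDensity (m : EuclideanSpace ℝ (Fin d)) (S : Matrix (Fin d) (Fin d) ℝ) :
    Measurable (logDensity m S) :=
  (continuous_logDensity m S).measurable

@[fun_prop]
theorem measurable_logDensityN (m : EuclideanSpace ℝ (Fin d)) (S : Matrix (Fin d) (Fin d) ℝ)
    (n : ℕ) : Measurable (logDensityN m S n) := by
  unfold logDensityN
  fun_prop

variable {S : Matrix (Fin d) (Fin d) ℝ}

theorem density_eq_ofReal_exp (hS : S.PosDef) (m x : EuclideanSpace ℝ (Fin d)) :
    density m S x = ENNReal.ofReal (Real.exp (logDensity m S x)) := by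
  have hD : 0 < (2 * Real.pi) ^ d * S.det := by
    have := hS.det_pos
    positivity
  have h1 : (Real.sqrt ((2 * Real.pi) ^ d * S.det))⁻¹
      = Real.exp (-(1 / 2) * Real.log ((2 * Real.pi) ^ d * S.det)) := by
    rw [neg_mul, Real.exp_neg, Real.sqrt_eq_rpow, Real.rpow_def_of_pos hD, mul_comm]
  rw [density, h1, ← Real.exp_add, logDensity, quad]
  congr 2
  ring

theorem densityN_eq_ofReal_exp (hS : S.PosDef) (m : EuclideanSpace ℝ (Fin d)) (n : ℕ)
    (u : Fin n → EuclideanSpace ℝ (Fin d)) :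
    densityN m S n u = ENNReal.ofReal (Real.exp (logDensityN m S n u)) := by
  rw [densityN, logDensityN, Real.exp_sum,
    ENNReal.ofReal_prod_of_nonneg fun i _ => (Real.exp_pos _).le]
  exact Finset.prod_congr rfl fun i _ => density_eq_ofReal_exp hS m (u i)

theorem measurable_density (hS : S.PosDef) (m : EuclideanSpace ℝ (Fin d)) :
    Measurable (density m S) := by
  rw [funext (density_eq_ofReal_exp hS m)]
  fun_prop

theorem measurable_densityN (hS : S.PosDef) (m : EuclideanSpace ℝ (Fin d)) (n : ℕ) :
    Measurable (densityN m S n) := by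
  rw [funext (densityN_eq_ofReal_exp hS m n)]
  fun_prop

theorem density_zero_one (x : EuclideanSpace ℝ (Fin d)) :
    density 0 (1 : Matrix (Fin d) (Fin d) ℝ) x = ∏ i, gaussianPDF 0 1 (x i) := by
  simp only [gaussianPDF, gaussianPDFReal]
  rw [← ENNReal.ofReal_prod_of_nonneg fun i _ => by positivity, Finset.prod_mul_distrib,
    ← Real.exp_sum, density]
  congr 2
  · simp only [Matrix.det_one, mul_one, NNReal.coe_one, Finset.prod_const, Finset.card_univ,
      Fintype.card_fin, inv_pow]
    rw [← Real.sqrt_sq (by positivity : 0 ≤ Real.sqrt (2 * Real.pi) ^ d), ← pow_mul, mul_comm d,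
      pow_mul, Real.sq_sqrt (by positivity)]
  · simp only [sub_zero, inv_one, one_mulVec, dotProduct, Finset.mul_sum, NNReal.coe_one, mul_one]
    congr 1
    refine Finset.sum_congr rfl fun i _ => ?_
    ring

theorem stdGaussian_eq_withDensity :
    stdGaussian (EuclideanSpace ℝ (Fin d))
      = volume.withDensity (density 0 (1 : Matrix (Fin d) (Fin d) ℝ)) := by
  have hg : gaussianReal 0 1 = volume.withDensity (gaussianPDF 0 1) :=
    gaussianReal_of_var_ne_zero 0 one_ne_zero
  have hm := measurable_gaussianPDF 0 1
  have hσ : SigmaFinite ((volume : Measure ℝ).withDensity (gaussianPDF 0 1)) :=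
    hg ▸ inferInstance
  rw [← map_pi_eq_stdGaussian, hg, pi_withDensity hm,
    funext (density_zero_one (d := d)), ← (PiLp.volume_preserving_toLp (Fin d)).map_eq]
  exact map_withDensity_comp (P := Measure.pi fun _ : Fin d => (volume : Measure ℝ))
    (Z := WithLp.toLp 2) (by fun_prop)
    (h := fun x : EuclideanSpace ℝ (Fin d) => ∏ i, gaussianPDF 0 1 (x i)) (by fun_prop)

/-- The distribution is the image of the standard Gaussian under x ↦ m + √S x. For positive definite
S the root is invertible with squared determinant det S, so a linear change of variables applies. -/
theorem multivariateGaussian_eq_withDensity (hS : S.PosDef) (m : EuclideanSpace ℝ (Fin d)) :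
    multivariateGaussian m S = volume.withDensity (density m S) := by
  open scoped MatrixOrder in
  set B := CFC.sqrt S with hB
  have hBB : B * B = S := CFC.sqrt_mul_sqrt_self S hS.posSemidef.nonneg
  have hBT : Bᵀ = B := by
    have : B.PosSemidef := Matrix.nonneg_iff_posSemidef.1 (CFC.sqrt_nonneg S)
    simpa using this.isHermitian.eq
  have hdet : B.det * B.det = S.det := by rw [← Matrix.det_mul, hBB]
  have hdet0 : B.det ≠ 0 := fun h => hS.det_pos.ne' (by rw [← hdet, h, zero_mul])
  have hBu : IsUnit B.det := isUnit_iff_ne_zero.2 hdet0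
  set T : EuclideanSpace ℝ (Fin d) →L[ℝ] EuclideanSpace ℝ (Fin d) := toEuclideanCLM (𝕜 := ℝ) B
    with hT
  have hTdet : LinearMap.det (T : EuclideanSpace ℝ (Fin d) →ₗ[ℝ] EuclideanSpace ℝ (Fin d))
      = B.det := by
    rw [hT, coe_toEuclideanCLM_eq_toEuclideanLin, Matrix.toEuclideanLin_eq_toLin_orthonormal,
      LinearMap.det_toLin]
  have hmapT : (volume : Measure (EuclideanSpace ℝ (Fin d))).map T
      = ENNReal.ofReal |B.det⁻¹| • volume := by
    rw [← hTdet]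
    exact Measure.map_linearMap_addHaar_eq_smul_addHaar volume (by rw [hTdet]; exact hdet0)
  have hmap : (volume : Measure (EuclideanSpace ℝ (Fin d))).map (fun x => m + T x)
      = ENNReal.ofReal |B.det⁻¹| • volume := by
    have : (fun x => m + T x) = (fun x => m + x) ∘ T := rfl
    rw [this, ← Measure.map_map (by fun_prop) (by fun_prop), hmapT, Measure.map_smul,
      map_add_left_eq_self]
  -- The standard density is written as a function of the transformed variable, so that it can be
  -- pulled through the image measure; the factor |det B| cancels the Jacobian.
  have hdens : density 0 (1 : Matrix (Fin d) (Fin d) ℝ)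
      = fun x => (ENNReal.ofReal |B.det| • density m S) (m + T x) := by
    ext x
    have hq : quad S⁻¹ (T x) = quad 1⁻¹ x := by
      have hS' : S⁻¹ = B⁻¹ * B⁻¹ := by rw [← hBB, Matrix.mul_inv_rev]
      have h1 : B * (B⁻¹ * B⁻¹ * B) = 1 := by
        rw [Matrix.mul_assoc, Matrix.nonsing_inv_mul _ hBu, Matrix.mul_one,
          Matrix.mul_nonsing_inv _ hBu]
      rw [quad, quad, hT, ofLp_toEuclideanCLM, mulVec_mulVec, hS', dotProduct_comm,
        dotProduct_mulVec, ← mulVec_transpose, hBT, mulVec_mulVec, h1, inv_one, dotProduct_comm]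
    rw [Pi.smul_apply, smul_eq_mul, density_eq_ofReal_exp Matrix.PosDef.one,
      density_eq_ofReal_exp hS, ← ENNReal.ofReal_mul (abs_nonneg _)]
    congr 1
    have h2 : |B.det| = Real.exp (1 / 2 * Real.log S.det) := by
      rw [← hdet, ← abs_mul_abs_self B.det, Real.log_mul (abs_ne_zero.2 hdet0)
        (abs_ne_zero.2 hdet0), ← two_mul, ← mul_assoc, one_div, inv_mul_cancel₀ two_ne_zero,
        one_mul, Real.exp_log (abs_pos.2 hdet0)]
    rw [h2, ← Real.exp_add, logDensity, logDensity, add_sub_cancel_left, sub_zero, hq,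
      Real.log_mul (by positivity) hS.det_pos.ne', Matrix.det_one, mul_one]
    congr 1
    ring
  have hmd := (measurable_density hS m)
  calc multivariateGaussian m S
      = (volume.withDensity (density 0 (1 : Matrix (Fin d) (Fin d) ℝ))).map
          (fun x => m + T x) := by rw [multivariateGaussian, stdGaussian_eq_withDensity]
    _ = (volume.map fun x => m + T x).withDensity (ENNReal.ofReal |B.det| • density m S) := by
        rw [hdens]
        exact map_withDensity_comp (by fun_prop) (hmd.const_smul _)
    _ = volume.withDensity (density m S) := by
        rw [hmap, withDensity_smul_measure, withDensity_smul _ hmd, smul_smul,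
          ← ENNReal.ofReal_mul (abs_nonneg _), ← abs_mul, inv_mul_cancel₀ hdet0, abs_one,
          ENNReal.ofReal_one, one_smul]

instance isProbabilityMeasure_iid {Ω : Type*} [MeasurableSpace Ω] (R : Measure Ω)
    [IsProbabilityMeasure R] (n : ℕ) : IsProbabilityMeasure (iid R n) := by
  unfold iid; infer_instance

theorem iid_eq_withDensity (hS : S.PosDef) (m : EuclideanSpace ℝ (Fin d)) (n : ℕ) :
    iid (multivariateGaussian m S) n = volume.withDensity (densityN m S n) := by
  have h := multivariateGaussian_eq_withDensity hS m
  have hσ : SigmaFinite (volume.withDensity (density m S)) := h ▸ inferInstance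
  rw [iid, h, pi_withDensity (measurable_density hS m)]
  rfl

theorem multivariateGaussian_eq_withDensity_exp (hS : S.PosDef) (m : EuclideanSpace ℝ (Fin d)) :
    multivariateGaussian m S
      = volume.withDensity fun x => ENNReal.ofReal (Real.exp (logDensity m S x)) := by
  rw [multivariateGaussian_eq_withDensity hS, funext (density_eq_ofReal_exp hS m)]

theorem iid_eq_withDensity_exp (hS : S.PosDef) (m : EuclideanSpace ℝ (Fin d)) (n : ℕ) :
    iid (multivariateGaussian m S) n
      = volume.withDensity fun x => ENNReal.ofReal (Real.exp (logDensityN m S n x)) := by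
  rw [iid_eq_withDensity hS, funext (densityN_eq_ofReal_exp hS m n)]

theorem volume_absolutelyContinuous_multivariateGaussian (hS : S.PosDef)
    (m : EuclideanSpace ℝ (Fin d)) : volume ≪ multivariateGaussian m S := by
  rw [multivariateGaussian_eq_withDensity_exp hS]
  exact withDensity_absolutelyContinuous' (by fun_prop) (ae_of_all _ fun x => by
    simp [Real.exp_pos])

theorem volume_absolutelyContinuous_iid (hS : S.PosDef)
    (m : EuclideanSpace ℝ (Fin d)) (n : ℕ) :
    volume ≪ iid (multivariateGaussian m S) n := by
  rw [iid_eq_withDensity_exp hS]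
  exact withDensity_absolutelyContinuous' (by fun_prop) (ae_of_all _ fun x => by
    simp [Real.exp_pos])

end Gauss

/-! ### Law of the statistic, and Gaussian mixtures over the location -/

section Laws

variable {d n : ℕ} {S S' : Matrix (Fin d) (Fin d) ℝ}

@[fun_prop]
theorem measurable_statZ : Measurable (statZ : (Fin n → EuclideanSpace ℝ (Fin d)) → _) := by
  unfold statZ
  fun_prop

theorem sqrt_natCast_pos (hn : 0 < n) : 0 < Real.sqrt n := Real.sqrt_pos.2 (by exact_mod_cast hn)

/-- The characteristic function of the sum is an n-th power, evaluated at t / √n: the quadratic term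
is unchanged and the linear one gains a factor √n. -/
theorem map_statZ_iid (hS : S.PosSemidef) (m : EuclideanSpace ℝ (Fin d)) (hn : 0 < n) :
    (iid (multivariateGaussian m S) n).map statZ
      = multivariateGaussian (Real.sqrt n • m) S := by
  have hsn := sqrt_natCast_pos hn
  have hnn : (Real.sqrt n : ℂ) * Real.sqrt n = n := by
    rw [← Complex.ofReal_mul, Real.mul_self_sqrt (Nat.cast_nonneg n), Complex.ofReal_natCast]
  have hs0 : (Real.sqrt n : ℂ) ≠ 0 := by exact_mod_cast hsn.ne'
  have : IsProbabilityMeasure ((iid (multivariateGaussian m S) n).map statZ) :=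
    Measure.isProbabilityMeasure_map (by fun_prop)
  refine Measure.ext_of_charFun ?_
  ext t
  have h1 : charFun ((iid (multivariateGaussian m S) n).map statZ) t
      = charFun ((iid (multivariateGaussian m S) n).map fun u => ∑ i, u i)
        ((Real.sqrt n)⁻¹ • t) :=
    charFun_map_smul_comp (X := Fin n → EuclideanSpace ℝ (Fin d)) (by fun_prop) _ _
  rw [h1, iid, charFun_map_sum_pi_eq_prod, Finset.prod_apply, Finset.prod_const,
    charFun_multivariateGaussian hS, charFun_multivariateGaussian hS, ← Complex.exp_nat_mul,
    Finset.card_univ, Fintype.card_fin]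
  congr 1
  rw [real_inner_smul_left, real_inner_smul_right]
  simp only [WithLp.ofLp_smul, smul_dotProduct, mulVec_smul, dotProduct_smul, smul_eq_mul]
  push_cast
  rw [← hnn]
  field_simp

/-- This accounts for the factor 1 / n in the prior covariance: on the scale √n m of the statistic
it disappears. -/
theorem map_smul_multivariateGaussian (hS : S.PosSemidef) (m : EuclideanSpace ℝ (Fin d))
    (hn : 0 < n) :
    (multivariateGaussian m ((n : ℝ)⁻¹ • S)).map (fun x => Real.sqrt n • x)
      = multivariateGaussian (Real.sqrt n • m) S := by
  have hn' : (0 : ℝ) < n := by exact_mod_cast hn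
  have hnn : (Real.sqrt n : ℂ) * Real.sqrt n = n := by
    rw [← Complex.ofReal_mul, Real.mul_self_sqrt (Nat.cast_nonneg n), Complex.ofReal_natCast]
  have hs0 : (Real.sqrt n : ℂ) ≠ 0 := by exact_mod_cast (sqrt_natCast_pos hn).ne'
  have hS' : ((n : ℝ)⁻¹ • S).PosSemidef := hS.smul (by positivity)
  have : IsProbabilityMeasure ((multivariateGaussian m ((n : ℝ)⁻¹ • S)).map
    (fun x => Real.sqrt n • x)) := Measure.isProbabilityMeasure_map (by fun_prop)
  refine Measure.ext_of_charFun ?_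
  ext t
  rw [charFun_map_smul, charFun_multivariateGaussian hS, charFun_multivariateGaussian hS']
  congr 1
  rw [real_inner_smul_left, real_inner_smul_right]
  simp only [WithLp.ofLp_smul, smul_dotProduct, mulVec_smul, dotProduct_smul, smul_eq_mul,
    smul_mulVec]
  push_cast
  rw [← hnn]
  field_simp

theorem multivariateGaussian_eq_map_add (m : EuclideanSpace ℝ (Fin d)) :
    multivariateGaussian m S = (multivariateGaussian 0 S).map fun x => m + x := by
  rw [multivariateGaussian, multivariateGaussian, Measure.map_map (by fun_prop) (by fun_prop)]
  congr 1
  ext x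
  simp

theorem multivariateGaussian_conv (hS : S.PosSemidef) (hS' : S'.PosSemidef)
    (m m' : EuclideanSpace ℝ (Fin d)) :
    (multivariateGaussian m S).conv (multivariateGaussian m' S')
      = multivariateGaussian (m + m') (S + S') := by
  refine Measure.ext_of_charFun ?_
  ext t
  rw [charFun_conv, charFun_multivariateGaussian hS, charFun_multivariateGaussian hS',
    charFun_multivariateGaussian (hS.add hS'), ← Complex.exp_add, inner_add_right, add_mulVec,
    dotProduct_add]
  congr 1
  push_cast
  ring

theorem measurable_density_uncurry (hS : S.PosDef) :
    Measurable fun x : EuclideanSpace ℝ (Fin d) × EuclideanSpace ℝ (Fin d) =>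
      density x.1 S x.2 := by
  simp_rw [density_eq_ofReal_exp hS]
  exact ENNReal.measurable_ofReal.comp
    (Real.measurable_exp.comp (continuous_logDensity_uncurry S).measurable)

theorem measurable_uncurry_density_swap (hS : S.PosDef) :
    Measurable (Function.uncurry fun z x : EuclideanSpace ℝ (Fin d) => density x S z) := by
  simp_rw [density_eq_ofReal_exp hS, logDensity]
  fun_prop

theorem measurable_density_left (hS : S.PosDef) (z : EuclideanSpace ℝ (Fin d)) :
    Measurable fun x => density x S z := by
  simp_rw [density_eq_ofReal_exp hS, logDensity]
  fun_prop

/-- A Gaussian mixture over the location is Gaussian. -/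
theorem withDensity_lintegral_density (hS : S.PosSemidef) (hS' : S'.PosDef)
    (m : EuclideanSpace ℝ (Fin d)) :
    volume.withDensity (fun z => ∫⁻ x, density x S' z ∂(multivariateGaussian m S))
      = multivariateGaussian m (S + S') := by
  -- A location mixture is the law of a location plus independent centred noise, hence a
  -- convolution.
  rw [← add_zero m, ← multivariateGaussian_conv hS hS'.posSemidef, add_zero]
  ext s hs
  have hm := measurable_uncurry_density_swap hS'
  have hadd : MeasurableSet ((fun x : EuclideanSpace ℝ (Fin d) × EuclideanSpace ℝ (Fin d) =>
      x.1 + x.2) ⁻¹' s) := (measurable_fst.add measurable_snd) hs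
  rw [withDensity_apply _ hs, lintegral_lintegral_swap hm.aemeasurable,
    Measure.conv, Measure.map_apply (by fun_prop) hs, Measure.prod_apply hadd]
  refine lintegral_congr fun x => ?_
  rw [← withDensity_apply _ hs, ← multivariateGaussian_eq_withDensity hS',
    multivariateGaussian_eq_map_add, Measure.map_apply (by fun_prop) hs]
  rfl

/-- Density of a Gaussian mixture over the location, in terms of the scaled location. -/
theorem lintegral_density_smul_ae_eq {Sp Sq : Matrix (Fin d) (Fin d) ℝ} (hSp : Sp.PosDef)
    (hSq : Sq.PosDef) (h : (Sq - Sp).PosSemidef) (m : EuclideanSpace ℝ (Fin d)) (hn : 0 < n) :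
    (fun z => ∫⁻ x, density (Real.sqrt n • x) Sp z
        ∂(multivariateGaussian m ((n : ℝ)⁻¹ • (Sq - Sp))))
      =ᵐ[volume] density (Real.sqrt n • m) Sq := by
  have h1 : ∀ z, ∫⁻ x, density (Real.sqrt n • x) Sp z
        ∂(multivariateGaussian m ((n : ℝ)⁻¹ • (Sq - Sp)))
      = ∫⁻ x, density x Sp z ∂(multivariateGaussian (Real.sqrt n • m) (Sq - Sp)) := fun z => by
    have hf := measurable_density_left hSp z
    have hg : Measurable fun x : EuclideanSpace ℝ (Fin d) => Real.sqrt n • x := by fun_prop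
    rw [← map_smul_multivariateGaussian h m hn, lintegral_map hf hg]
  simp_rw [h1]
  have hm : Measurable fun z => ∫⁻ x, density x Sp z
      ∂(multivariateGaussian (Real.sqrt n • m) (Sq - Sp)) :=
    (measurable_density_uncurry hSp).lintegral_prod_left'
  have h2 := withDensity_lintegral_density h hSp (Real.sqrt n • m)
  rw [sub_add_cancel, multivariateGaussian_eq_withDensity hSq] at h2
  refine ((withDensity_eq_iff (measurable_density hSq _).aemeasurable hm.aemeasurable ?_).1
    h2.symm).symm
  rw [← setLIntegral_univ, ← withDensity_apply _ MeasurableSet.univ,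
    ← multivariateGaussian_eq_withDensity hSq]
  exact measure_ne_top _ _

end Laws

/-! ### Sufficiency of the statistic and maximum likelihood -/

section Decomposition

variable {d n : ℕ} {S : Matrix (Fin d) (Fin d) ℝ}

theorem quad_sub {A : Matrix (Fin d) (Fin d) ℝ} (hA : Aᵀ = A) (v w : EuclideanSpace ℝ (Fin d)) :
    quad A (v - w) = quad A v - 2 * (w.ofLp ⬝ᵥ (A *ᵥ v.ofLp)) + quad A w := by
  have h : v.ofLp ⬝ᵥ (A *ᵥ w.ofLp) = w.ofLp ⬝ᵥ (A *ᵥ v.ofLp) := by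
    rw [dotProduct_mulVec, ← mulVec_transpose, hA, dotProduct_comm]
  simp only [quad, WithLp.ofLp_sub, mulVec_sub, sub_dotProduct, dotProduct_sub, h]
  ring

theorem quad_smul (A : Matrix (Fin d) (Fin d) ℝ) (c : ℝ) (v : EuclideanSpace ℝ (Fin d)) :
    quad A (c • v) = c * c * quad A v := by
  simp only [quad, WithLp.ofLp_smul, smul_dotProduct, mulVec_smul, dotProduct_smul, smul_eq_mul]
  ring

/-- Completing the square: m meets the data only in the cross term with ∑ u_i = √n Z, and its own
n-fold square is that of √n m. -/
theorem sum_quad_sub {A : Matrix (Fin d) (Fin d) ℝ} (hA : Aᵀ = A) (hn : 0 < n)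
    (m : EuclideanSpace ℝ (Fin d)) (u : Fin n → EuclideanSpace ℝ (Fin d)) :
    ∑ i, quad A (u i - m)
      = ∑ i, quad A (u i) - quad A (statZ u) + quad A (statZ u - Real.sqrt n • m) := by
  have hs := (sqrt_natCast_pos hn).ne'
  have hnn : Real.sqrt n * Real.sqrt n = n := Real.mul_self_sqrt (Nat.cast_nonneg n)
  simp_rw [quad_sub hA]
  rw [Finset.sum_add_distrib, Finset.sum_sub_distrib, ← Finset.mul_sum, ← dotProduct_sum,
    ← mulVec_sum, Finset.sum_const, Finset.card_univ, Fintype.card_fin, quad_smul, hnn,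
    nsmul_eq_mul]
  have : (∑ i, (u i).ofLp) = Real.sqrt n • (statZ u).ofLp := by
    rw [statZ, WithLp.ofLp_smul, smul_smul, mul_inv_cancel₀ hs, one_smul, WithLp.ofLp_sum]
  rw [this, mulVec_smul, dotProduct_smul, WithLp.ofLp_smul, smul_dotProduct]
  ring

theorem transpose_inv_of_posDef (hS : S.PosDef) : S⁻¹ᵀ = S⁻¹ := by
  simpa using hS.inv.isHermitian.eq

/-- The mean enters the likelihood through the statistic only. -/
theorem logDensityN_sub_logDensityN (hS : S.PosDef) (hn : 0 < n)
    (m m' : EuclideanSpace ℝ (Fin d)) (u : Fin n → EuclideanSpace ℝ (Fin d)) :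
    logDensityN m S n u - logDensityN m' S n u
      = logDensity (Real.sqrt n • m) S (statZ u) - logDensity (Real.sqrt n • m') S (statZ u) := by
  have hT := transpose_inv_of_posDef hS
  simp only [logDensityN, logDensity]
  simp only [Finset.sum_sub_distrib, ← Finset.mul_sum]
  rw [sum_quad_sub hT hn, sum_quad_sub hT hn m']
  ring

theorem quad_nonneg (hS : S.PosSemidef) (v : EuclideanSpace ℝ (Fin d)) : 0 ≤ quad S v := by
  simpa [quad] using hS.dotProduct_mulVec_nonneg v.ofLp

theorem quad_zero (A : Matrix (Fin d) (Fin d) ℝ) : quad A 0 = 0 := by simp [quad]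

theorem sqrt_smul_mle (u : Fin n → EuclideanSpace ℝ (Fin d)) :
    Real.sqrt n • mle u = statZ u := by
  rw [mle, statZ, smul_smul, ← div_eq_mul_inv, Real.sqrt_div_self]

/-- At the sample mean √n m equals Z, so the quadratic form in the density of Z vanishes; the excess
over any other m is the form that is left there. -/
theorem logDensityN_mle (hS : S.PosDef) (hn : 0 < n)
    (m : EuclideanSpace ℝ (Fin d)) (u : Fin n → EuclideanSpace ℝ (Fin d)) :
    logDensityN (mle u) S n u
      = logDensityN m S n u + 1 / 2 * quad S⁻¹ (statZ u - Real.sqrt n • m) := by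
  have h := logDensityN_sub_logDensityN hS hn (mle u) m u
  rw [sqrt_smul_mle, logDensity, logDensity, sub_self, quad_zero] at h
  linarith

theorem iSup_densityN (hS : S.PosDef) (hn : 0 < n) (u : Fin n → EuclideanSpace ℝ (Fin d)) :
    ⨆ m, densityN m S n u = densityN (mle u) S n u := by
  refine le_antisymm (iSup_le fun m => ?_) (le_iSup (fun m => densityN m S n u) _)
  rw [densityN_eq_ofReal_exp hS, densityN_eq_ofReal_exp hS, logDensityN_mle hS hn m]
  have := quad_nonneg hS.inv.posSemidef (statZ u - Real.sqrt n • m)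
  exact ENNReal.ofReal_le_ofReal (Real.exp_le_exp.2 (by linarith))

end Decomposition

/-! ### Expected log-densities under the sampling distribution -/

section Moments

variable {d n : ℕ} {R : Measure (EuclideanSpace ℝ (Fin d))} {m : EuclideanSpace ℝ (Fin d)}
  {Sr : Matrix (Fin d) (Fin d) ℝ}

theorem memLp_coord (hR : MemLp id 2 R) (i : Fin d) :
    MemLp (fun x : EuclideanSpace ℝ (Fin d) => x i) 2 R :=
  (EuclideanSpace.proj (𝕜 := ℝ) i).comp_memLp' hR

theorem quad_eq_sum (A : Matrix (Fin d) (Fin d) ℝ) (v : EuclideanSpace ℝ (Fin d)) :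
    quad A v = ∑ i, ∑ j, A i j * (v i * v j) := by
  simp only [quad, dotProduct, mulVec, Finset.mul_sum]
  exact Finset.sum_congr rfl fun i _ => Finset.sum_congr rfl fun j _ => by ring

theorem quad_sub_eq_sum (A : Matrix (Fin d) (Fin d) ℝ) (x m : EuclideanSpace ℝ (Fin d)) :
    quad A (x - m) = ∑ i, ∑ j, A i j * ((x i - m i) * (x j - m j)) :=
  quad_eq_sum A (x - m)

variable [IsProbabilityMeasure R]

theorem integral_coord (hR : MemLp id 2 R) (hm : ∫ x, x ∂ R = m) (i : Fin d) :
    ∫ x : EuclideanSpace ℝ (Fin d), x i ∂ R = m i := by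
  rw [← hm]
  exact (EuclideanSpace.proj (𝕜 := ℝ) i).integral_comp_comm
    (hR.integrable one_le_two)

theorem integrable_coord_sub_mul (hR : MemLp id 2 R) (m : EuclideanSpace ℝ (Fin d))
    (i j : Fin d) :
    Integrable (fun x : EuclideanSpace ℝ (Fin d) => (x i - m i) * (x j - m j)) R :=
  ((memLp_coord hR i).sub (memLp_const _)).integrable_mul
    ((memLp_coord hR j).sub (memLp_const _))

theorem integrable_quad_sub (hR : MemLp id 2 R) (A : Matrix (Fin d) (Fin d) ℝ)
    (m : EuclideanSpace ℝ (Fin d)) : Integrable (fun x => quad A (x - m)) R := by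
  simp_rw [quad_sub_eq_sum]
  exact integrable_finsetSum _ fun i _ => integrable_finsetSum _ fun j _ =>
    (integrable_coord_sub_mul hR m i j).const_mul _

theorem integral_quad_sub (hR : MemLp id 2 R) (hm : ∫ x, x ∂ R = m)
    (hcov : ∀ i j, covariance (fun x => x i) (fun x => x j) R = Sr i j)
    (A : Matrix (Fin d) (Fin d) ℝ) : ∫ x, quad A (x - m) ∂ R = (Sr * A).trace := by
  have hi := integrable_coord_sub_mul hR m
  have hc : ∀ i j, ∫ x : EuclideanSpace ℝ (Fin d), (x i - m i) * (x j - m j) ∂ R = Sr j i := by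
    intro i j
    rw [← hcov, covariance_comm, covariance, integral_coord hR hm, integral_coord hR hm]
  calc ∫ x, quad A (x - m) ∂ R
      = ∫ x, ∑ i, ∑ j, A i j * ((x i - m i) * (x j - m j)) ∂ R :=
        integral_congr_ae (ae_of_all _ fun x => quad_sub_eq_sum A x m)
    _ = ∑ i, ∫ x, ∑ j, A i j * ((x i - m i) * (x j - m j)) ∂ R :=
        integral_finsetSum _ fun i _ => integrable_finsetSum _ fun j _ => (hi i j).const_mul _
    _ = ∑ i, ∑ j, ∫ x, A i j * ((x i - m i) * (x j - m j)) ∂ R :=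
        Finset.sum_congr rfl fun i _ => integral_finsetSum _ fun j _ => (hi i j).const_mul _
    _ = ∑ i, ∑ j, A i j * Sr j i :=
        Finset.sum_congr rfl fun i _ => Finset.sum_congr rfl fun j _ => by
          rw [integral_const_mul, hc]
    _ = (Sr * A).trace := by
        rw [Matrix.trace, Finset.sum_comm]
        refine Finset.sum_congr rfl fun j _ => ?_
        rw [Matrix.diag_apply, Matrix.mul_apply]
        exact Finset.sum_congr rfl fun i _ => mul_comm _ _

theorem integrable_logDensity (hR : MemLp id 2 R) (m : EuclideanSpace ℝ (Fin d))
    (S : Matrix (Fin d) (Fin d) ℝ) : Integrable (logDensity m S) R :=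
  (integrable_const _).sub ((integrable_quad_sub hR S⁻¹ m).const_mul _)

theorem integral_logDensity (hR : MemLp id 2 R) (hm : ∫ x, x ∂ R = m)
    (hcov : ∀ i j, covariance (fun x => x i) (fun x => x j) R = Sr i j)
    (S : Matrix (Fin d) (Fin d) ℝ) :
    ∫ x, logDensity m S x ∂ R
      = -(1 / 2) * Real.log ((2 * Real.pi) ^ d * S.det) - 1 / 2 * (Sr * S⁻¹).trace := by
  simp only [logDensity]
  rw [integral_sub (integrable_const _) ((integrable_quad_sub hR S⁻¹ m).const_mul _),
    integral_const, integral_const_mul, integral_quad_sub hR hm hcov]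
  simp

/-- The value of the generalized divergence of Gaussian distributions with a common mean. -/
noncomputable def gaussKL (Sp Sq Sr : Matrix (Fin d) (Fin d) ℝ) : ℝ :=
  (-(1 / 2) * Real.log ((2 * Real.pi) ^ d * Sq.det) - 1 / 2 * (Sr * Sq⁻¹).trace)
    - (-(1 / 2) * Real.log ((2 * Real.pi) ^ d * Sp.det) - 1 / 2 * (Sr * Sp⁻¹).trace)

theorem integral_logDensity_sub (hR : MemLp id 2 R) (hm : ∫ x, x ∂ R = m)
    (hcov : ∀ i j, covariance (fun x => x i) (fun x => x j) R = Sr i j)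
    (Sp Sq : Matrix (Fin d) (Fin d) ℝ) :
    ∫ x, (logDensity m Sq x - logDensity m Sp x) ∂ R = gaussKL Sp Sq Sr := by
  rw [integral_sub (integrable_logDensity hR m Sq) (integrable_logDensity hR m Sp),
    integral_logDensity hR hm hcov, integral_logDensity hR hm hcov, gaussKL]

theorem memLp_eval_iid (hR : MemLp id 2 R) (k : Fin n) :
    MemLp (fun u : Fin n → EuclideanSpace ℝ (Fin d) => u k) 2 (iid R n) :=
  hR.comp_measurePreserving (measurePreserving_eval (fun _ : Fin n => R) k)

theorem memLp_map_statZ (hR : MemLp id 2 R) : MemLp id 2 ((iid R n).map statZ) := by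
  rw [memLp_map_measure_iff aestronglyMeasurable_id (by fun_prop)]
  have h : MemLp (fun u : Fin n → EuclideanSpace ℝ (Fin d) => ∑ k, u k) 2 (iid R n) :=
    memLp_finsetSum _ fun k _ => memLp_eval_iid hR k
  exact h.const_smul (Real.sqrt n)⁻¹

theorem integral_map_statZ (hR : MemLp id 2 R) (hm : ∫ x, x ∂ R = m) :
    ∫ z, z ∂((iid R n).map statZ) = Real.sqrt n • m := by
  rw [integral_map (f := fun z => z) (by fun_prop) (by fun_prop)]
  simp only [statZ]
  rw [integral_smul, integral_finsetSum _ fun k _ =>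
    (memLp_eval_iid hR k).integrable one_le_two]
  have h : ∀ k : Fin n, ∫ u : Fin n → EuclideanSpace ℝ (Fin d), u k ∂(iid R n) = m := fun k => by
    rw [← hm]
    exact integral_comp_eval (μ := fun _ : Fin n => R) (f := id) aestronglyMeasurable_id
  simp_rw [h]
  rw [Finset.sum_const, Finset.card_univ, Fintype.card_fin, ← Nat.cast_smul_eq_nsmul ℝ, smul_smul,
    mul_comm, ← div_eq_mul_inv, Real.div_sqrt]

/-- Distinct outcomes are uncorrelated, so n equal terms remain, and the two factors n^{-1/2} cancel
them. All single-outcome moment formulas therefore apply to Z with the same covariance. -/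
theorem covariance_map_statZ (hR : MemLp id 2 R)
    (hcov : ∀ i j, covariance (fun x => x i) (fun x => x j) R = Sr i j) (hn : 0 < n)
    (i j : Fin d) :
    covariance (fun x => x i) (fun x => x j) ((iid R n).map statZ) = Sr i j := by
  have hnn : Real.sqrt n * Real.sqrt n = n := Real.mul_self_sqrt (Nat.cast_nonneg n)
  have hmem : ∀ (i : Fin d) (k : Fin n),
      MemLp (fun u : Fin n → EuclideanSpace ℝ (Fin d) => u k i) 2 (iid R n) := fun i k =>
    (memLp_coord hR i).comp_measurePreserving (measurePreserving_eval (fun _ : Fin n => R) k)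
  have hcoord : ∀ i : Fin d, (fun u : Fin n → EuclideanSpace ℝ (Fin d) => (statZ u) i)
      = fun u => (Real.sqrt n)⁻¹ * ∑ k, u k i := fun i => by
    ext u
    simp [statZ]
  rw [covariance_map_fun (by fun_prop) (by fun_prop) (by fun_prop), hcoord, hcoord,
    covariance_const_mul_left, covariance_const_mul_right,
    covariance_fun_sum_fun_sum (hmem i) (hmem j)]
  have hkl : ∀ k l : Fin n, covariance (fun u : Fin n → EuclideanSpace ℝ (Fin d) => u k i)
      (fun u => u l j) (iid R n) = if k = l then Sr i j else 0 := by
    intro k l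
    split_ifs with h
    · subst h
      have e := covariance_map_fun (μ := iid R n) (X := fun x : EuclideanSpace ℝ (Fin d) => x i)
        (Y := fun x => x j) (Z := fun u : Fin n → EuclideanSpace ℝ (Fin d) => u k)
        (by fun_prop) (by fun_prop) (measurable_pi_apply k).aemeasurable
      have e' : (iid R n).map (fun u => u k) = R :=
        (measurePreserving_eval (fun _ : Fin n => R) k).map_eq
      rw [← hcov, ← e, e']
    · have hind : iIndepFun (fun (k : Fin n) (u : Fin n → EuclideanSpace ℝ (Fin d)) => u k)
          (iid R n) := iIndepFun_pi (X := fun _ => id) fun _ => aemeasurable_id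
      have h2 := (hind.indepFun h).comp (φ := fun x => x i) (ψ := fun x => x j) (by fun_prop)
        (by fun_prop)
      exact h2.covariance_eq_zero (hmem i k) (hmem j l)
  simp_rw [hkl]
  simp only [Finset.sum_ite_eq, Finset.mem_univ, if_true, Finset.sum_const, Finset.card_univ,
    Fintype.card_fin, nsmul_eq_mul]
  rw [← mul_assoc, ← mul_assoc, ← mul_inv, hnn,
    inv_mul_cancel₀ (by exact_mod_cast hn.ne'), one_mul]

theorem integrable_logDensity_statZ (hR : MemLp id 2 R) (m : EuclideanSpace ℝ (Fin d))
    (S : Matrix (Fin d) (Fin d) ℝ) :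
    Integrable (fun u : Fin n → EuclideanSpace ℝ (Fin d) => logDensity m S (statZ u))
      (iid R n) := by
  have : IsProbabilityMeasure ((iid R n).map statZ) :=
    Measure.isProbabilityMeasure_map (by fun_prop)
  exact (integrable_logDensity (memLp_map_statZ hR) m S).comp_measurable measurable_statZ

theorem integral_logDensity_sub_statZ (hR : MemLp id 2 R) (hm : ∫ x, x ∂ R = m)
    (hcov : ∀ i j, covariance (fun x => x i) (fun x => x j) R = Sr i j)
    (Sp Sq : Matrix (Fin d) (Fin d) ℝ) (hn : 0 < n) :
    ∫ u, (logDensity (Real.sqrt n • m) Sq (statZ u) - logDensity (Real.sqrt n • m) Sp (statZ u))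
      ∂(iid R n) = gaussKL Sp Sq Sr := by
  have : IsProbabilityMeasure ((iid R n).map statZ) :=
    Measure.isProbabilityMeasure_map (by fun_prop)
  rw [← integral_logDensity_sub (memLp_map_statZ hR) (integral_map_statZ hR hm)
    (covariance_map_statZ hR hcov hn), integral_map (by fun_prop) (by fun_prop)]

theorem integral_quad_statZ (hR : MemLp id 2 R) (hm : ∫ x, x ∂ R = m)
    (hcov : ∀ i j, covariance (fun x => x i) (fun x => x j) R = Sr i j)
    (A : Matrix (Fin d) (Fin d) ℝ) (hn : 0 < n) :
    ∫ u, quad A (statZ u - Real.sqrt n • m) ∂(iid R n) = (Sr * A).trace := by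
  have : IsProbabilityMeasure ((iid R n).map statZ) :=
    Measure.isProbabilityMeasure_map (by fun_prop)
  rw [← integral_quad_sub (memLp_map_statZ hR) (integral_map_statZ hR hm)
    (covariance_map_statZ hR hcov hn), integral_map (by fun_prop) (by fun_prop)]

theorem integrable_quad_statZ (hR : MemLp id 2 R) (A : Matrix (Fin d) (Fin d) ℝ)
    (m : EuclideanSpace ℝ (Fin d)) :
    Integrable (fun u : Fin n → EuclideanSpace ℝ (Fin d) => quad A (statZ u - m)) (iid R n) := by
  have : IsProbabilityMeasure ((iid R n).map statZ) :=
    Measure.isProbabilityMeasure_map (by fun_prop)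
  exact (integrable_quad_sub (memLp_map_statZ hR) A m).comp_measurable measurable_statZ

theorem integrable_logDensityN (hR : MemLp id 2 R) (m : EuclideanSpace ℝ (Fin d))
    (S : Matrix (Fin d) (Fin d) ℝ) : Integrable (logDensityN m S n) (iid R n) :=
  integrable_finsetSum _ fun _ _ =>
    integrable_comp_eval (μ := fun _ : Fin n => R) (integrable_logDensity hR m S)

theorem integral_logDensityN (hR : MemLp id 2 R) (m : EuclideanSpace ℝ (Fin d))
    (S : Matrix (Fin d) (Fin d) ℝ) :
    ∫ u, logDensityN m S n u ∂(iid R n) = n * ∫ x, logDensity m S x ∂ R := by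
  have h := fun k : Fin n => integral_comp_eval (μ := fun _ : Fin n => R) (i := k)
    (integrable_logDensity hR m S).aestronglyMeasurable
  simp only [logDensityN, iid]
  rw [integral_finsetSum _ fun k _ =>
    integrable_comp_eval (μ := fun _ : Fin n => R) (integrable_logDensity hR m S)]
  simp only [h, Finset.sum_const, Finset.card_univ, Fintype.card_fin, nsmul_eq_mul]

theorem integral_logDensityN_sub (hR : MemLp id 2 R) (hm : ∫ x, x ∂ R = m)
    (hcov : ∀ i j, covariance (fun x => x i) (fun x => x j) R = Sr i j)
    (Sp Sq : Matrix (Fin d) (Fin d) ℝ) :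
    ∫ u, (logDensityN m Sq n u - logDensityN m Sp n u) ∂(iid R n) = n * gaussKL Sp Sq Sr := by
  rw [integral_sub (integrable_logDensityN hR m Sq) (integrable_logDensityN hR m Sp),
    integral_logDensityN hR, integral_logDensityN hR, ← mul_sub,
    ← integral_sub (integrable_logDensity hR m Sq) (integrable_logDensity hR m Sp),
    integral_logDensity_sub hR hm hcov]

/-- The covariance matrix of an absolutely continuous distribution is regular. -/
theorem det_ne_zero_of_absolutelyContinuous (hR : MemLp id 2 R) (hm : ∫ x, x ∂ R = m)
    (hcov : ∀ i j, covariance (fun x => x i) (fun x => x j) R = Sr i j) (hac : R ≪ volume) :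
    Sr.det ≠ 0 := by
  intro h0
  -- If Σr v = 0, the variance of ⟨v, x⟩ is zero, so `R` is concentrated on an affine hyperplane,
  -- which is Lebesgue-null.
  obtain ⟨v, hv0, hv⟩ := Matrix.exists_mulVec_eq_zero_iff.2 h0
  set L : EuclideanSpace ℝ (Fin d) →L[ℝ] ℝ := innerSL ℝ (WithLp.toLp 2 v) with hL
  have hLx : ∀ x, L x = ∑ i, v i * x i := fun x => by
    simp [hL, PiLp.inner_apply, mul_comm]
  have hq : ∀ x, quad (vecMulVec v v) (x - m) = (L x - L m) ^ 2 := fun x => by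
    rw [← map_sub, hLx, quad_eq_sum, sq, Finset.sum_mul_sum]
    refine Finset.sum_congr rfl fun i _ => Finset.sum_congr rfl fun j _ => ?_
    rw [vecMulVec_apply]; ring
  have hint := integral_quad_sub hR hm hcov (vecMulVec v v)
  have hi := integrable_quad_sub hR (vecMulVec v v) m
  simp_rw [hq] at hint hi
  rw [mul_vecMulVec, hv, zero_vecMulVec, Matrix.trace_zero,
    integral_eq_zero_iff_of_nonneg (fun x => sq_nonneg _) hi] at hint
  have hae : ∀ᵐ x ∂ R, L x = L m := by
    filter_upwards [hint] with x hx
    have : (L x - L m) ^ 2 = 0 := hx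
    nlinarith
  set s : AffineSubspace ℝ (EuclideanSpace ℝ (Fin d)) :=
    AffineSubspace.mk' m (LinearMap.ker (L : EuclideanSpace ℝ (Fin d) →ₗ[ℝ] ℝ)) with hs
  have hsm : ∀ x, x ∈ s ↔ L x = L m := fun x => by
    rw [hs, AffineSubspace.mem_mk', LinearMap.mem_ker]
    simp [sub_eq_zero]
  have hst : s ≠ ⊤ := by
    intro htop
    have h1 : L (m + WithLp.toLp 2 v) = L m := (hsm _).1 (htop ▸ AffineSubspace.mem_top ℝ _ _)
    rw [map_add, add_eq_left, hL, innerSL_apply_apply, inner_self_eq_zero] at h1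
    exact hv0 (by simpa using h1)
  have hz : R (s : Set (EuclideanSpace ℝ (Fin d))) = 0 :=
    hac (Measure.addHaar_affineSubspace volume s hst)
  have hone : R (s : Set (EuclideanSpace ℝ (Fin d)))ᶜ = 0 := by
    exact measure_mono_null (fun x hx hx2 => hx ((hsm x).2 hx2)) (ae_iff.1 hae)
  have := measure_univ (μ := R)
  rw [← Set.union_compl_self (s : Set (EuclideanSpace ℝ (Fin d)))] at this
  have h2 := measure_union_le (μ := R) (s : Set (EuclideanSpace ℝ (Fin d))) (↑s)ᶜ
  rw [this, hz, hone] at h2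
  simp at h2

/-- The terms d and log det Σr cancel between the two values of `DGauss`. Regularity of Σr is what
allows the logarithms of the determinants to be split. -/
theorem gaussKL_eq_DSigma {Sp Sq : Matrix (Fin d) (Fin d) ℝ} (hSp : Sp.PosDef) (hSq : Sq.PosDef)
    (h : Sr.det ≠ 0) : gaussKL Sp Sq Sr = DSigma Sr Sq Sp := by
  have hp := hSp.det_pos
  have hq := hSq.det_pos
  rw [gaussKL, DSigma, DGauss, DGauss, Matrix.det_mul, Matrix.det_mul, Matrix.det_nonsing_inv,
    Matrix.det_nonsing_inv, Ring.inverse_eq_inv', Real.log_mul h (inv_ne_zero hp.ne'),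
    Real.log_mul h (inv_ne_zero hq.ne'), Real.log_mul (by positivity) hp.ne',
    Real.log_mul (by positivity) hq.ne', Real.log_inv, Real.log_inv]
  ring

end Moments

theorem ofReal_exp_div (a b : ℝ) :
    ENNReal.ofReal (Real.exp a) / ENNReal.ofReal (Real.exp b)
      = ENNReal.ofReal (Real.exp (a - b)) := by
  rw [← ENNReal.ofReal_div_of_pos (Real.exp_pos _), ← Real.exp_sub]

theorem withDensity_exp_eq_withDensity {Ω : Type*} [MeasurableSpace Ω] {ν : Measure Ω}
    {a b : Ω → ℝ} (ha : Measurable a) (hb : Measurable b) :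
    ν.withDensity (fun x => ENNReal.ofReal (Real.exp (a x)))
      = (ν.withDensity fun x => ENNReal.ofReal (Real.exp (b x))).withDensity
          fun x => ENNReal.ofReal (Real.exp (a x - b x)) := by
  rw [← withDensity_mul _ (by fun_prop) (by fun_prop)]
  congr 1
  ext x
  rw [Pi.mul_apply, ← ENNReal.ofReal_mul (Real.exp_pos _).le, ← Real.exp_add,
    add_sub_cancel]

/-! ### Likelihood ratios in the Gaussian location model -/

section Model

variable {d n : ℕ} {Sp Sq : Matrix (Fin d) (Fin d) ℝ}

theorem densityN_div_densityN (hSp : Sp.PosDef) (hSq : Sq.PosDef)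
    (m m' : EuclideanSpace ℝ (Fin d)) (u : Fin n → EuclideanSpace ℝ (Fin d)) :
    densityN m Sq n u / densityN m' Sp n u
      = ENNReal.ofReal (Real.exp (logDensityN m Sq n u - logDensityN m' Sp n u)) := by
  rw [densityN_eq_ofReal_exp hSp, densityN_eq_ofReal_exp hSq, ofReal_exp_div]

theorem density_div_density (hSp : Sp.PosDef) (hSq : Sq.PosDef)
    (m m' x : EuclideanSpace ℝ (Fin d)) :
    density m Sq x / density m' Sp x
      = ENNReal.ofReal (Real.exp (logDensity m Sq x - logDensity m' Sp x)) := by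
  rw [density_eq_ofReal_exp hSp, density_eq_ofReal_exp hSq, ofReal_exp_div]

theorem densityN_div_densityN_eq_prod (hSp : Sp.PosDef) (hSq : Sq.PosDef)
    (m m' : EuclideanSpace ℝ (Fin d)) (u : Fin n → EuclideanSpace ℝ (Fin d)) :
    densityN m Sq n u / densityN m' Sp n u = ∏ i, density m Sq (u i) / density m' Sp (u i) := by
  simp_rw [density_div_density hSp hSq]
  rw [densityN_div_densityN hSp hSq, ← ENNReal.ofReal_prod_of_nonneg
    (fun i _ => (Real.exp_pos _).le), ← Real.exp_sum, Finset.sum_sub_distrib]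
  rfl

theorem absolutelyContinuous_iid {R : Measure (EuclideanSpace ℝ (Fin d))}
    [IsProbabilityMeasure R] (hR : R ≪ volume) : iid R n ≪ volume := by
  have h := Measure.withDensity_rnDeriv_eq R volume hR
  have : SigmaFinite (volume.withDensity (R.rnDeriv volume)) := h ▸ inferInstance
  rw [iid, ← h, pi_withDensity (Measure.measurable_rnDeriv _ _)]
  exact withDensity_absolutelyContinuous _ _

theorem iid_multivariateGaussian_absolutelyContinuous (hS : Sp.PosDef)
    (m : EuclideanSpace ℝ (Fin d)) : iid (multivariateGaussian m Sp) n ≪ volume := by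
  rw [iid_eq_withDensity hS]
  exact withDensity_absolutelyContinuous _ _

theorem multivariateGaussian_absolutelyContinuous (hS : Sp.PosDef)
    (m : EuclideanSpace ℝ (Fin d)) : multivariateGaussian m Sp ≪ volume := by
  rw [multivariateGaussian_eq_withDensity hS]
  exact withDensity_absolutelyContinuous _ _

/-! ### Universal inference -/

section UI

variable {R : Measure (EuclideanSpace ℝ (Fin d))} [IsProbabilityMeasure R]
  {m : EuclideanSpace ℝ (Fin d)} {Sr : Matrix (Fin d) (Fin d) ℝ}

theorem uiEVariable_eq (hSp : Sp.PosDef) (hn : 0 < n) (m : EuclideanSpace ℝ (Fin d))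
    (u : Fin n → EuclideanSpace ℝ (Fin d)) :
    uiEVariable m Sp Sq n u = densityN m Sq n u / densityN (mle u) Sp n u := by
  rw [uiEVariable, iSup_densityN hSp hn]

theorem ePower_uiEVariable (hSp : Sp.PosDef) (hSq : Sq.PosDef) (hR : MemLp id 2 R)
    (hm : ∫ x, x ∂ R = m)
    (hcov : ∀ i j, covariance (fun x => x i) (fun x => x j) R = Sr i j) (hn : 0 < n) :
    ePower (iid R n) (uiEVariable m Sp Sq n)
      = ((n * gaussKL Sp Sq Sr - dTr Sr Sp / 2 : ℝ) : EReal) := by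
  have hi : Integrable (fun u => logDensityN m Sq n u - logDensityN m Sp n u) (iid R n) :=
    (integrable_logDensityN hR m Sq).sub (integrable_logDensityN hR m Sp)
  have hi' : Integrable (fun u : Fin n → EuclideanSpace ℝ (Fin d) =>
      1 / 2 * quad Sp⁻¹ (statZ u - Real.sqrt n • m)) (iid R n) :=
    (integrable_quad_statZ hR Sp⁻¹ _).const_mul _
  rw [ePower_eq_integral (L := fun u => logDensityN m Sq n u - logDensityN m Sp n u
    - 1 / 2 * quad Sp⁻¹ (statZ u - Real.sqrt n • m)) (ae_of_all _ fun u => ?_) (hi.sub hi'),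
    integral_sub hi hi', integral_const_mul, integral_quad_statZ hR hm hcov _ hn,
    integral_logDensityN_sub hR hm hcov, dTr]
  · congr 1
    ring
  · rw [uiEVariable_eq hSp hn, densityN_div_densityN hSp hSq, logDensityN_mle hSp hn m]
    congr 2
    ring

end UI

/-! ### The conditional e-variable -/

section COND

/-- Logarithm of the conditional e-variable. -/
noncomputable def condLog (m : EuclideanSpace ℝ (Fin d)) (Sp Sq : Matrix (Fin d) (Fin d) ℝ)
    (n : ℕ) (u : Fin n → EuclideanSpace ℝ (Fin d)) : ℝ :=
  (logDensityN m Sq n u - logDensityN m Sp n u)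
    - (logDensity (Real.sqrt n • m) Sq (statZ u) - logDensity (Real.sqrt n • m) Sp (statZ u))

theorem iid_eq_withDensity_iid (hSp : Sp.PosDef) (hSq : Sq.PosDef)
    (m : EuclideanSpace ℝ (Fin d)) :
    iid (multivariateGaussian m Sq) n = (iid (multivariateGaussian m Sp) n).withDensity
      fun u => ENNReal.ofReal (Real.exp (logDensityN m Sq n u - logDensityN m Sp n u)) := by
  rw [iid_eq_withDensity_exp hSp, iid_eq_withDensity_exp hSq]
  exact withDensity_exp_eq_withDensity (by fun_prop) (by fun_prop)

theorem map_statZ_eq_withDensity_map_statZ (hSp : Sp.PosDef) (hSq : Sq.PosDef)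
    (m : EuclideanSpace ℝ (Fin d)) (hn : 0 < n) :
    (iid (multivariateGaussian m Sq) n).map statZ
      = ((iid (multivariateGaussian m Sp) n).map statZ).withDensity
        fun z => ENNReal.ofReal (Real.exp
          (logDensity (Real.sqrt n • m) Sq z - logDensity (Real.sqrt n • m) Sp z)) := by
  rw [map_statZ_iid hSp.posSemidef m hn, map_statZ_iid hSq.posSemidef m hn,
    multivariateGaussian_eq_withDensity_exp hSp, multivariateGaussian_eq_withDensity_exp hSq]
  exact withDensity_exp_eq_withDensity (by fun_prop) (by fun_prop)

theorem iid_eq_withDensity_comp_statZ (hSp : Sp.PosDef) (m m' : EuclideanSpace ℝ (Fin d))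
    (hn : 0 < n) :
    iid (multivariateGaussian m' Sp) n = (iid (multivariateGaussian m Sp) n).withDensity
      fun u => ENNReal.ofReal (Real.exp (logDensity (Real.sqrt n • m') Sp (statZ u)
        - logDensity (Real.sqrt n • m) Sp (statZ u))) := by
  have h := withDensity_exp_eq_withDensity (ν := volume) (measurable_logDensityN m' Sp n)
    (measurable_logDensityN m Sp n)
  rw [← iid_eq_withDensity_exp hSp, ← iid_eq_withDensity_exp hSp] at h
  rw [h]
  congr 1
  funext u
  rw [logDensityN_sub_logDensityN hSp hn]

theorem exists_isCondEVariable_gaussian (hSp : Sp.PosDef) (m : EuclideanSpace ℝ (Fin d))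
    (hn : 0 < n) :
    ∃ S, IsCondEVariable (locationFamilyN Sp n) (iid (multivariateGaussian m Sq) n) statZ S := by
  refine exists_isCondEVariable (P := iid (multivariateGaussian m Sp) n) measurable_statZ ?_
  rintro _ ⟨m', rfl⟩
  exact ⟨fun z => ENNReal.ofReal (Real.exp (logDensity (Real.sqrt n • m') Sp z
    - logDensity (Real.sqrt n • m) Sp z)), by fun_prop, iid_eq_withDensity_comp_statZ hSp m m' hn⟩

theorem IsCondEVariable.ae_eq_exp_condLog (hSp : Sp.PosDef) (hSq : Sq.PosDef)
    {m : EuclideanSpace ℝ (Fin d)} (hn : 0 < n)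
    {S : (Fin n → EuclideanSpace ℝ (Fin d)) → ℝ≥0∞}
    (hS : IsCondEVariable (locationFamilyN Sp n) (iid (multivariateGaussian m Sq) n) statZ S) :
    S =ᵐ[volume] fun u => ENNReal.ofReal (Real.exp (condLog m Sp Sq n u)) := by
  have hP : iid (multivariateGaussian m Sp) n ∈ locationFamilyN Sp n := ⟨m, rfl⟩
  have h := hS.ae_eq measurable_statZ hP
    (f := fun u => ENNReal.ofReal (Real.exp (logDensityN m Sq n u - logDensityN m Sp n u)))
    (g := fun z => ENNReal.ofReal (Real.exp
      (logDensity (Real.sqrt n • m) Sq z - logDensity (Real.sqrt n • m) Sp z)))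
    (by fun_prop) (by fun_prop) (fun z => by simp [Real.exp_pos]) (fun z => ENNReal.ofReal_ne_top)
    (iid_eq_withDensity_iid hSp hSq m) (map_statZ_eq_withDensity_map_statZ hSp hSq m hn)
  filter_upwards [(volume_absolutelyContinuous_iid hSp m n).ae_le h] with u hu
  rw [hu, ofReal_exp_div, condLog]

theorem integrable_condLog {R : Measure (EuclideanSpace ℝ (Fin d))} [IsProbabilityMeasure R]
    (hR : MemLp id 2 R) (m : EuclideanSpace ℝ (Fin d)) (Sp Sq : Matrix (Fin d) (Fin d) ℝ) :
    Integrable (condLog m Sp Sq n) (iid R n) :=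
  ((integrable_logDensityN hR m Sq).sub (integrable_logDensityN hR m Sp)).sub
    ((integrable_logDensity_statZ hR _ Sq).sub (integrable_logDensity_statZ hR _ Sp))

theorem ePower_of_isCondEVariable (hSp : Sp.PosDef) (hSq : Sq.PosDef)
    {R : Measure (EuclideanSpace ℝ (Fin d))} [IsProbabilityMeasure R]
    {m : EuclideanSpace ℝ (Fin d)} {Sr : Matrix (Fin d) (Fin d) ℝ} (hR : MemLp id 2 R)
    (hm : ∫ x, x ∂ R = m)
    (hcov : ∀ i j, covariance (fun x => x i) (fun x => x j) R = Sr i j) (hn : 0 < n)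
    (hac : R ≪ volume) {S : (Fin n → EuclideanSpace ℝ (Fin d)) → ℝ≥0∞}
    (hS : IsCondEVariable (locationFamilyN Sp n) (iid (multivariateGaussian m Sq) n) statZ S) :
    ePower (iid R n) S = (((n - 1) * gaussKL Sp Sq Sr : ℝ) : EReal) := by
  rw [ePower_eq_integral ((absolutelyContinuous_iid hac).ae_le
    (hS.ae_eq_exp_condLog hSp hSq hn)) (integrable_condLog hR m Sp Sq)]
  have e : ∫ u, condLog m Sp Sq n u ∂(iid R n)
      = ∫ u, (logDensityN m Sq n u - logDensityN m Sp n u) ∂(iid R n)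
        - ∫ u, (logDensity (Real.sqrt n • m) Sq (statZ u)
          - logDensity (Real.sqrt n • m) Sp (statZ u)) ∂(iid R n) :=
    integral_sub ((integrable_logDensityN hR m Sq).sub (integrable_logDensityN hR m Sp))
      ((integrable_logDensity_statZ hR _ Sq).sub (integrable_logDensity_statZ hR _ Sp))
  rw [e, integral_logDensityN_sub hR hm hcov, integral_logDensity_sub_statZ hR hm hcov _ _ hn]
  congr 1
  ring

end COND

/-! ### The simple case -/

section Simple

theorem map_inner_multivariateGaussian (hSq : Sq.PosSemidef) (m w : EuclideanSpace ℝ (Fin d)) :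
    (multivariateGaussian m Sq).map (innerSL ℝ w)
      = gaussianReal (inner ℝ w m) (quad Sq w).toNNReal := by
  rw [IsGaussian.map_eq_gaussianReal, ContinuousLinearMap.integral_comp_id_comm
    IsGaussian.integrable_id, integral_id_multivariateGaussian]
  congr 2
  rw [← covariance_self (by fun_prop)]
  have := covarianceBilin_apply_eq_cov (μ := multivariateGaussian m Sq)
    IsGaussian.memLp_two_id w w
  rw [covarianceBilin_multivariateGaussian hSq] at this
  exact this.symm

theorem lintegral_exp_inner_multivariateGaussian (hSq : Sq.PosSemidef)
    (m w : EuclideanSpace ℝ (Fin d)) :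
    ∫⁻ x, ENNReal.ofReal (Real.exp (inner ℝ w x)) ∂(multivariateGaussian m Sq)
      = ENNReal.ofReal (Real.exp (inner ℝ w m + quad Sq w / 2)) := by
  have h := mgf_gaussianReal (map_inner_multivariateGaussian hSq m w) 1
  have hq := quad_nonneg hSq w
  rw [mgf, Real.coe_toNNReal _ hq] at h
  simp only [one_mul, mul_one, one_pow] at h
  -- A non-integrable function has Bochner integral 0, which the strictly positive value of the
  -- moment generating function excludes.
  have hi : Integrable (fun x => Real.exp (innerSL ℝ w x)) (multivariateGaussian m Sq) := by
    by_contra hcon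
    rw [integral_undef hcon] at h
    exact (Real.exp_pos _).ne h
  rw [← h, ofReal_integral_eq_lintegral_ofReal hi (ae_of_all _ fun x => (Real.exp_pos _).le)]
  rfl

theorem logDensity_sub_eq_inner (hSp : Sp.PosDef) (m m' x : EuclideanSpace ℝ (Fin d)) :
    logDensity m' Sp x - logDensity m Sp x
      = inner ℝ (WithLp.toLp 2 (Sp⁻¹ *ᵥ (m' - m).ofLp)) (x - m) - 1 / 2 * quad Sp⁻¹ (m' - m) := by
  have hT := transpose_inv_of_posDef hSp
  have h := quad_sub hT (x - m) (m' - m)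
  rw [sub_sub_sub_cancel_right] at h
  have hin : inner ℝ (WithLp.toLp 2 (Sp⁻¹ *ᵥ (m' - m).ofLp)) (x - m)
      = (m' - m).ofLp ⬝ᵥ (Sp⁻¹ *ᵥ (x - m).ofLp) := by
    rw [dotProduct_mulVec, ← mulVec_transpose, hT, EuclideanSpace.inner_eq_star_dotProduct,
      dotProduct_comm]
    simp
  rw [hin, logDensity, logDensity, h]
  ring

/-- The integral equals E_Q[p_m' / p_m], whose log-ratio is affine in x with slope w = Σp⁻¹ (m' -
m). The Gaussian moment generating function gives exp ((wᵀ Σq w - wᵀ Σp w) / 2), which is at most 1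
in the simple case. -/
theorem lintegral_density_div_density_le_one (hSp : Sp.PosDef) (hSq : Sq.PosDef)
    (h : (Sp - Sq).PosSemidef) (m m' : EuclideanSpace ℝ (Fin d)) :
    ∫⁻ x, density m Sq x / density m Sp x ∂(multivariateGaussian m' Sp) ≤ 1 := by
  set w : EuclideanSpace ℝ (Fin d) := WithLp.toLp 2 (Sp⁻¹ *ᵥ (m' - m).ofLp) with hw
  have hT := transpose_inv_of_posDef hSp
  have hle : quad Sq w ≤ quad Sp⁻¹ (m' - m) := by
    have h1 := quad_nonneg h w
    have h2 : quad (Sp - Sq) w = quad Sp w - quad Sq w := by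
      simp [quad, sub_mulVec, dotProduct_sub]
    have h3 : quad Sp w = quad Sp⁻¹ (m' - m) := by
      rw [quad, quad, hw]
      simp only
      rw [mulVec_mulVec, Matrix.mul_nonsing_inv _ (isUnit_iff_ne_zero.2 hSp.det_pos.ne'),
        one_mulVec, dotProduct_comm]
    linarith
  have hm1 : Measurable fun x => ENNReal.ofReal (Real.exp
      (logDensity m Sq x - logDensity m Sp x)) := by fun_prop
  have hm2 : Measurable fun x => ENNReal.ofReal (Real.exp
      (logDensity m' Sp x - logDensity m Sp x)) := by fun_prop
  calc ∫⁻ x, density m Sq x / density m Sp x ∂(multivariateGaussian m' Sp)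
      = ∫⁻ x, ENNReal.ofReal (Real.exp (logDensity m' Sp x)) * ENNReal.ofReal (Real.exp
          (logDensity m Sq x - logDensity m Sp x)) := by
        simp_rw [density_div_density hSp hSq]
        rw [multivariateGaussian_eq_withDensity_exp hSp,
          lintegral_withDensity_mul (by fun_prop) hm1]
    _ = ∫⁻ x, ENNReal.ofReal (Real.exp (logDensity m Sq x)) * ENNReal.ofReal (Real.exp
          (logDensity m' Sp x - logDensity m Sp x)) := by
        refine lintegral_congr fun x => ?_
        rw [← ENNReal.ofReal_mul (Real.exp_pos _).le, ← ENNReal.ofReal_mul (Real.exp_pos _).le,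
          ← Real.exp_add, ← Real.exp_add]
        congr 2
        ring
    _ = ∫⁻ x, ENNReal.ofReal (Real.exp (logDensity m' Sp x - logDensity m Sp x))
          ∂(multivariateGaussian m Sq) := by
        rw [multivariateGaussian_eq_withDensity_exp hSq,
          lintegral_withDensity_mul (by fun_prop) hm2]
    _ = ∫⁻ x, ENNReal.ofReal (Real.exp (-(inner ℝ w m + 1 / 2 * quad Sp⁻¹ (m' - m))))
          * ENNReal.ofReal (Real.exp (inner ℝ w x)) ∂(multivariateGaussian m Sq) := by
        refine lintegral_congr fun x => ?_
        rw [logDensity_sub_eq_inner hSp, ← hw, ← ENNReal.ofReal_mul (Real.exp_pos _).le,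
          ← Real.exp_add, inner_sub_right]
        congr 2
        ring
    _ ≤ 1 := by
        rw [lintegral_const_mul _ (by fun_prop), lintegral_exp_inner_multivariateGaussian
          hSq.posSemidef, ← ENNReal.ofReal_mul (Real.exp_pos _).le, ← Real.exp_add,
          ← ENNReal.ofReal_one]
        refine ENNReal.ofReal_le_ofReal (Real.exp_le_one_iff.2 ?_)
        linarith

theorem lintegral_densityN_div_densityN_le_one (hSp : Sp.PosDef) (hSq : Sq.PosDef)
    (h : (Sp - Sq).PosSemidef) (m m' : EuclideanSpace ℝ (Fin d)) :
    ∫⁻ u, densityN m Sq n u / densityN m Sp n u ∂(iid (multivariateGaussian m' Sp) n) ≤ 1 := by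
  simp_rw [densityN_div_densityN_eq_prod hSp hSq]
  rw [iid, lintegral_fin_prod_eq_prod (f := fun _ x => density m Sq x / density m Sp x)
    fun _ => (measurable_density hSq m).div (measurable_density hSp m)]
  exact Finset.prod_le_one' fun _ _ => lintegral_density_div_density_le_one hSp hSq h m m'

/-- The candidate belongs to the null hypothesis, so the infimum is attained there and no
approximation is needed. -/
theorem isRIPr_density (hSp : Sp.PosDef) (hSq : Sq.PosDef)
    (h : (Sp - Sq).PosSemidef) (m : EuclideanSpace ℝ (Fin d)) :
    IsRIPr volume (multivariateGaussian m Sq) (convexHull ℝ≥0 (locationFamily Sp))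
      (density m Sp) := by
  have hR : MemLp id 2 (multivariateGaussian m Sq) := IsGaussian.memLp_two_id
  have hq := integrable_logDensity hR m Sq
  have hp := integrable_logDensity hR m Sp
  have hC := mem_convexHull_of_forall_lintegral_le_one (ν := volume) (H₀ := locationFamily Sp)
    (S := fun x => density m Sq x / density m Sp x) (by
      rintro _ ⟨m', rfl⟩
      exact ⟨inferInstance, multivariateGaussian_absolutelyContinuous hSp m',
        lintegral_density_div_density_le_one hSp hSq h m m'⟩)
  refine isRIPr_of_lintegral_div_le_one (multivariateGaussian_eq_withDensity hSq m)
    (measurable_density hSq m) (measurable_density hSp m) ?_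
    (ae_of_all _ fun x => density_div_density hSp hSq m m x) (hq.sub hp)
    (fun P hP => ⟨(hC P hP).1, (hC P hP).2.1⟩) (fun P hP => (hC P hP).2.2) fun ε hε =>
    ⟨multivariateGaussian m Sp, subset_convexHull _ _ ⟨m, rfl⟩, ?_⟩
  · rw [← setLIntegral_univ, ← withDensity_apply _ MeasurableSet.univ,
      ← multivariateGaussian_eq_withDensity hSp, measure_univ]
  · have hkl := klDiv_withDensity_ofReal_exp (by fun_prop) (by fun_prop)
      (multivariateGaussian_eq_withDensity_exp hSq m)
      (multivariateGaussian_eq_withDensity_exp hSp m) hq hp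
    exact ⟨hkl.1, by rw [hkl.2, integral_sub hq hp]; linarith⟩

theorem isRIPr_densityN (hSp : Sp.PosDef) (hSq : Sq.PosDef)
    (h : (Sp - Sq).PosSemidef) (m : EuclideanSpace ℝ (Fin d)) (n : ℕ) :
    IsRIPr volume (iid (multivariateGaussian m Sq) n) (convexHull ℝ≥0 (locationFamilyN Sp n))
      (densityN m Sp n) := by
  have hR : MemLp id 2 (multivariateGaussian m Sq) := IsGaussian.memLp_two_id
  have hq : Integrable (logDensityN m Sq n) _ := integrable_logDensityN hR m Sq
  have hp : Integrable (logDensityN m Sp n) _ := integrable_logDensityN hR m Sp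
  have hC := mem_convexHull_of_forall_lintegral_le_one (ν := volume) (H₀ := locationFamilyN Sp n)
    (S := fun x => densityN m Sq n x / densityN m Sp n x) (by
      rintro _ ⟨m', rfl⟩
      exact ⟨inferInstance, iid_multivariateGaussian_absolutelyContinuous hSp m',
        lintegral_densityN_div_densityN_le_one hSp hSq h m m'⟩)
  refine isRIPr_of_lintegral_div_le_one (iid_eq_withDensity hSq m n)
    (measurable_densityN hSq m n) (measurable_densityN hSp m n) ?_
    (ae_of_all _ fun x => densityN_div_densityN hSp hSq m m x) (hq.sub hp)
    (fun P hP => ⟨(hC P hP).1, (hC P hP).2.1⟩) (fun P hP => (hC P hP).2.2) fun ε hε =>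
    ⟨iid (multivariateGaussian m Sp) n, subset_convexHull _ _ ⟨m, rfl⟩, ?_⟩
  · rw [← setLIntegral_univ, ← withDensity_apply _ MeasurableSet.univ,
      ← iid_eq_withDensity hSp, measure_univ]
  · have hkl := klDiv_withDensity_ofReal_exp (by fun_prop) (by fun_prop)
      (iid_eq_withDensity_exp hSq m n)
      (iid_eq_withDensity_exp hSp m n) hq hp
    exact ⟨hkl.1, by rw [hkl.2, integral_sub hq hp]; linarith⟩

theorem isGrowthOptimal_densityN (hSp : Sp.PosDef) (hSq : Sq.PosDef)
    (h : (Sp - Sq).PosSemidef) (m : EuclideanSpace ℝ (Fin d)) (n : ℕ) :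
    IsGrowthOptimal (iid (multivariateGaussian m Sq) n) (locationFamilyN Sp n)
      (fun u => densityN m Sq n u / densityN m Sp n u) := by
  have hR : MemLp id 2 (multivariateGaussian m Sq) := IsGaussian.memLp_two_id
  refine isGrowthOptimal_of_lintegral_mul_le_one (iid_eq_withDensity hSq m n)
    (measurable_densityN hSq m n) (measurable_densityN hSp m n)
    (ae_of_all _ fun x => densityN_div_densityN hSp hSq m m x)
    ((integrable_logDensityN hR m Sq).sub (integrable_logDensityN hR m Sp))
    ⟨(measurable_densityN hSq m n).div (measurable_densityN hSp m n), ?_⟩ fun S' hS' => ?_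
  · rintro _ ⟨m', rfl⟩
    exact lintegral_densityN_div_densityN_le_one hSp hSq h m m'
  · have := hS'.2 _ ⟨m, rfl⟩
    simp only [iid_eq_withDensity hSp] at this
    rw [lintegral_withDensity_mul (measurable_densityN hSp m n) hS'.1] at this
    simpa only [mul_comm] using this

end Simple

/-! ### Uniqueness Lebesgue-almost everywhere -/

section Uniqueness

/-- Projections are unique up to Q-null sets, and these are Lebesgue-null because the density of Q
is positive. -/
theorem IsRIPrEVariable.ae_eq_of_isRIPr (hSq : Sq.PosDef) {m : EuclideanSpace ℝ (Fin d)}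
    {p S : (Fin n → EuclideanSpace ℝ (Fin d)) → ℝ≥0∞}
    {H₀ : Set (Measure (Fin n → EuclideanSpace ℝ (Fin d)))}
    (hp : IsRIPr volume (iid (multivariateGaussian m Sq) n) (convexHull ℝ≥0 H₀) p)
    (hS : IsRIPrEVariable volume (iid (multivariateGaussian m Sq) n) (densityN m Sq n) H₀ S) :
    S =ᵐ[volume] fun u => densityN m Sq n u / p u := by
  obtain ⟨p', hp', rfl⟩ := hS
  have h := (volume_absolutelyContinuous_iid hSq m n).ae_le
    (hp'.ae_eq (iid_multivariateGaussian_absolutelyContinuous hSq m) hp)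
  filter_upwards [h] with u hu
  rw [hu]

theorem IsSeqRIPrEVariable.ae_eq_of_isRIPr (hSq : Sq.PosDef) {m : EuclideanSpace ℝ (Fin d)}
    {p : EuclideanSpace ℝ (Fin d) → ℝ≥0∞} {S : (Fin n → EuclideanSpace ℝ (Fin d)) → ℝ≥0∞}
    {H₀ : Set (Measure (EuclideanSpace ℝ (Fin d)))}
    (hp : IsRIPr volume (multivariateGaussian m Sq) (convexHull ℝ≥0 H₀) p)
    (hS : IsSeqRIPrEVariable volume (multivariateGaussian m Sq) (density m Sq) H₀ n S) :
    S =ᵐ[volume] fun u => ∏ i, density m Sq (u i) / p (u i) := by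
  obtain ⟨p', hp', rfl⟩ := hS
  have h : ∀ᵐ u : Fin n → EuclideanSpace ℝ (Fin d), ∀ i, p' i (u i) = p (u i) := by
    rw [ae_all_iff]
    intro i
    have h1 := (volume_absolutelyContinuous_multivariateGaussian hSq m).ae_le
      ((hp' i).ae_eq (multivariateGaussian_absolutelyContinuous hSq m) hp)
    exact (Measure.quasiMeasurePreserving_eval
      (fun _ : Fin n => (volume : Measure (EuclideanSpace ℝ (Fin d)))) i).ae h1
  filter_upwards [h] with u hu
  exact Finset.prod_congr rfl fun i _ => by rw [hu i]

end Uniqueness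

/-! ### The anti-simple case -/

section AntiSimple

theorem lintegral_density_ae_eq (hSp : Sp.PosDef) (hSq : Sq.PosDef) (h : (Sq - Sp).PosSemidef)
    (m : EuclideanSpace ℝ (Fin d)) :
    (fun z => ∫⁻ x, density x Sp z ∂(multivariateGaussian m (Sq - Sp)))
      =ᵐ[volume] density m Sq := by
  simpa using lintegral_density_smul_ae_eq hSp hSq h m one_pos

theorem logDensity_le (hS : Sp.PosDef) (m x : EuclideanSpace ℝ (Fin d)) :
    logDensity m Sp x ≤ -(1 / 2) * Real.log ((2 * Real.pi) ^ d * Sp.det) := by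
  have := quad_nonneg hS.inv.posSemidef (x - m)
  rw [logDensity]
  linarith

/-- Q is itself the mixture with prior N(m, Σq - Σp), so q / p = 1 is trivially an e-variable and L
= 0. What remains is to approximate Q in divergence by finite mixtures. -/
theorem isRIPr_density_self (hSp : Sp.PosDef) (hSq : Sq.PosDef)
    (h : (Sq - Sp).PosSemidef) (m : EuclideanSpace ℝ (Fin d)) :
    IsRIPr volume (multivariateGaussian m Sq) (convexHull ℝ≥0 (locationFamily Sp))
      (density m Sq) := by
  have hR : MemLp id 2 (multivariateGaussian m Sq) := IsGaussian.memLp_two_id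
  have hone : ∀ x, density m Sq x / density m Sq x = 1 := fun x => by
    rw [density_div_density hSq hSq]; simp
  have hC := mem_convexHull_of_forall_lintegral_le_one (ν := volume) (H₀ := locationFamily Sp)
    (S := fun x => density m Sq x / density m Sq x) (by
      rintro _ ⟨m', rfl⟩
      exact ⟨inferInstance, multivariateGaussian_absolutelyContinuous hSp m', by simp [hone]⟩)
  have hfam : locationFamily Sp = Set.range fun m' => volume.withDensity fun u =>
      ENNReal.ofReal (Real.exp (logDensity m' Sp u)) := by
    rw [locationFamily]
    simp_rw [multivariateGaussian_eq_withDensity_exp hSp]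
  refine isRIPr_of_lintegral_div_le_one (L := fun x => logDensity m Sq x - logDensity m Sq x)
    (multivariateGaussian_eq_withDensity hSq m)
    (measurable_density hSq m) (measurable_density hSq m) ?_
    (ae_of_all _ fun x => density_div_density hSq hSq m m x)
    ((integrable_logDensity hR m Sq).sub (integrable_logDensity hR m Sq))
    (fun P hP => ⟨(hC P hP).1, (hC P hP).2.1⟩) (fun P hP => (hC P hP).2.2) fun ε hε => ?_
  · rw [← setLIntegral_univ, ← withDensity_apply _ MeasurableSet.univ,
      ← multivariateGaussian_eq_withDensity hSq, measure_univ]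
  · rw [hfam]
    refine exists_mem_convexHull_klDiv_le (l := fun m x => logDensity m Sp x) (by fun_prop)
      (multivariateGaussian_eq_withDensity_exp hSq m) (integrable_logDensity hR m Sq)
      (continuous_logDensity_uncurry Sp).measurable
      (fun u => by simp only [logDensity]; fun_prop) (logDensity_le hSp)
      (fun m' => by rw [← multivariateGaussian_eq_withDensity_exp hSp]; infer_instance)
      m (integrable_logDensity hR m Sp) (multivariateGaussian m (Sq - Sp)) ?_
      (integrable_logDensity hR m Sq) hε
    have h1 := (multivariateGaussian_absolutelyContinuous hSq m).ae_le
      (lintegral_density_ae_eq hSp hSq h m)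
    filter_upwards [h1] with u hu
    simp_rw [← density_eq_ofReal_exp hSp, ← density_eq_ofReal_exp hSq]
    exact hu

theorem continuous_logDensityN_left (u : Fin n → EuclideanSpace ℝ (Fin d)) :
    Continuous fun m => logDensityN m Sp n u := by
  simp only [logDensityN, logDensity]
  fun_prop

theorem measurable_logDensityN_uncurry :
    Measurable (Function.uncurry fun m u => logDensityN m Sp n u) := by
  have h : Continuous fun x : EuclideanSpace ℝ (Fin d) × (Fin n → EuclideanSpace ℝ (Fin d)) =>
      logDensityN x.1 Sp n x.2 := by
    simp only [logDensityN, logDensity]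
    fun_prop
  exact h.measurable

theorem measurable_densityN_uncurry (hSp : Sp.PosDef) :
    Measurable (Function.uncurry fun m u => densityN m Sp n u) := by
  have h : (Function.uncurry fun m u => densityN m Sp n u) = fun x => ENNReal.ofReal
      (Real.exp (Function.uncurry (fun m u => logDensityN m Sp n u) x)) := by
    ext x
    exact densityN_eq_ofReal_exp hSp x.1 n x.2
  rw [h]
  exact ENNReal.measurable_ofReal.comp (Real.measurable_exp.comp measurable_logDensityN_uncurry)

theorem measurable_mixtureN (hSp : Sp.PosDef) (W : Measure (EuclideanSpace ℝ (Fin d)))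
    [SFinite W] : Measurable (mixtureN W Sp n) :=
  (measurable_densityN_uncurry hSp).lintegral_prod_left'

/-- Tonelli. With S = 1 it yields the total mass of the mixture; with an e-variable S it yields ∫ S
p ≤ 1, the optimality criterion. -/
theorem lintegral_mul_mixtureN (hSp : Sp.PosDef) (W : Measure (EuclideanSpace ℝ (Fin d)))
    [SFinite W] {S : (Fin n → EuclideanSpace ℝ (Fin d)) → ℝ≥0∞} (hS : Measurable S) :
    ∫⁻ u, S u * mixtureN W Sp n u
      = ∫⁻ m, ∫⁻ u, S u ∂(iid (multivariateGaussian m Sp) n) ∂W := by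
  have hm := measurable_densityN_uncurry (n := n) hSp
  calc ∫⁻ u, S u * mixtureN W Sp n u
      = ∫⁻ u, ∫⁻ m, S u * densityN m Sp n u ∂W := by
        refine lintegral_congr fun u => ?_
        rw [mixtureN, lintegral_const_mul _ (hm.of_uncurry_right)]
    _ = ∫⁻ m, ∫⁻ u, S u * densityN m Sp n u ∂volume ∂W := by
        refine lintegral_lintegral_swap ?_
        exact ((hS.comp measurable_fst).mul (hm.comp measurable_swap)).aemeasurable
    _ = _ := by
        refine lintegral_congr fun m => ?_
        rw [iid_eq_withDensity hSp, lintegral_withDensity_mul (measurable_densityN hSp m n) hS]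
        simp only [mul_comm]

/-- Given Z, the mixture behaves like every P_m, and under the prior Z has the same law as under Q.
Only the conditional log-ratio separates it from q. -/
theorem mixtureN_ae_eq (hSp : Sp.PosDef) (hSq : Sq.PosDef) (h : (Sq - Sp).PosSemidef)
    (m : EuclideanSpace ℝ (Fin d)) (hn : 0 < n) :
    mixtureN (multivariateGaussian m ((n : ℝ)⁻¹ • (Sq - Sp))) Sp n =ᵐ[volume] fun u =>
      ENNReal.ofReal (Real.exp (logDensityN m Sq n u - condLog m Sp Sq n u)) := by
  have hae : ∀ᵐ u : Fin n → EuclideanSpace ℝ (Fin d),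
      ∫⁻ x, density (Real.sqrt n • x) Sp (statZ u)
        ∂(multivariateGaussian m ((n : ℝ)⁻¹ • (Sq - Sp)))
      = density (Real.sqrt n • m) Sq (statZ u) := by
    -- The identity for densities of Z holds off a null set of values z. Its preimage under the
    -- statistic is null for the sample law, which dominates Lebesgue measure.
    have h1 := (multivariateGaussian_absolutelyContinuous hSp (Real.sqrt n • m)).ae_le
      (lintegral_density_smul_ae_eq hSp hSq h m hn)
    rw [← map_statZ_iid hSp.posSemidef m hn] at h1
    exact (volume_absolutelyContinuous_iid hSp m n).ae_le
      (ae_of_ae_map measurable_statZ.aemeasurable h1)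
  filter_upwards [hae] with u hu
  -- Factorization through Z: the first factor is constant in the mean x and leaves the integral
  -- over the prior.
  have h1 : ∀ x, densityN x Sp n u = ENNReal.ofReal (Real.exp (logDensityN m Sp n u
      - logDensity (Real.sqrt n • m) Sp (statZ u))) * density (Real.sqrt n • x) Sp (statZ u) := by
    intro x
    have := logDensityN_sub_logDensityN hSp hn x m u
    rw [densityN_eq_ofReal_exp hSp, density_eq_ofReal_exp hSp,
      ← ENNReal.ofReal_mul (Real.exp_pos _).le, ← Real.exp_add]
    congr 2
    linarith
  have hmeas : Measurable fun x => density (Real.sqrt n • x) Sp (statZ u) :=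
    (measurable_density_left hSp (statZ u)).comp (measurable_const_smul (Real.sqrt n))
  rw [mixtureN]
  simp_rw [h1]
  rw [lintegral_const_mul _ hmeas, hu, density_eq_ofReal_exp hSq,
    ← ENNReal.ofReal_mul (Real.exp_pos _).le, ← Real.exp_add, condLog]
  congr 2
  ring

theorem densityN_div_mixtureN_ae_eq (hSp : Sp.PosDef) (hSq : Sq.PosDef)
    (h : (Sq - Sp).PosSemidef) (m : EuclideanSpace ℝ (Fin d)) (hn : 0 < n) :
    (fun u => densityN m Sq n u
      / mixtureN (multivariateGaussian m ((n : ℝ)⁻¹ • (Sq - Sp))) Sp n u)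
      =ᵐ[volume] fun u => ENNReal.ofReal (Real.exp (condLog m Sp Sq n u)) := by
  filter_upwards [mixtureN_ae_eq hSp hSq h m hn] with u hu
  rw [hu, densityN_eq_ofReal_exp hSq, ofReal_exp_div, sub_sub_cancel]

/-- Each P_m' has a density relative to P_m that is a function of Z, so the bound for quotients of
likelihood ratios of data and statistic applies. -/
theorem lintegral_densityN_div_mixtureN_le_one (hSp : Sp.PosDef) (hSq : Sq.PosDef)
    (h : (Sq - Sp).PosSemidef) (m m' : EuclideanSpace ℝ (Fin d)) (hn : 0 < n) :
    ∫⁻ u, densityN m Sq n u / mixtureN (multivariateGaussian m ((n : ℝ)⁻¹ • (Sq - Sp))) Sp n u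
      ∂(iid (multivariateGaussian m' Sp) n) ≤ 1 := by
  rw [lintegral_congr_ae ((iid_multivariateGaussian_absolutelyContinuous hSp m').ae_le
    (densityN_div_mixtureN_ae_eq hSp hSq h m hn))]
  have e := iid_eq_withDensity_comp_statZ hSp m m' hn
  have : IsProbabilityMeasure ((iid (multivariateGaussian m Sp) n).withDensity
      fun u => ENNReal.ofReal (Real.exp (logDensity (Real.sqrt n • m') Sp (statZ u)
        - logDensity (Real.sqrt n • m) Sp (statZ u)))) :=
    e ▸ inferInstance
  have key := lintegral_div_comp_le_one measurable_statZ (by fun_prop) (by fun_prop)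
    (by fun_prop) (iid_eq_withDensity_iid hSp hSq m)
    (map_statZ_eq_withDensity_map_statZ hSp hSq m hn)
    (h := fun z => ENNReal.ofReal (Real.exp
        (logDensity (Real.sqrt n • m') Sp z - logDensity (Real.sqrt n • m) Sp z)))
  simp_rw [ofReal_exp_div] at key
  rw [e]
  exact key

theorem isRIPr_mixtureN (hSp : Sp.PosDef) (hSq : Sq.PosDef)
    (h : (Sq - Sp).PosSemidef) (m : EuclideanSpace ℝ (Fin d)) (hn : 0 < n) :
    IsRIPr volume (iid (multivariateGaussian m Sq) n) (convexHull ℝ≥0 (locationFamilyN Sp n))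
      (mixtureN (multivariateGaussian m ((n : ℝ)⁻¹ • (Sq - Sp))) Sp n) := by
  have hR : MemLp id 2 (multivariateGaussian m Sq) := IsGaussian.memLp_two_id
  have hq : Integrable (logDensityN m Sq n) _ := integrable_logDensityN hR m Sq
  have hL : Integrable (condLog m Sp Sq n) _ := integrable_condLog hR m Sp Sq
  have hQ := iid_multivariateGaussian_absolutelyContinuous (n := n) hSq m
  have hC := mem_convexHull_of_forall_lintegral_le_one (ν := volume) (H₀ := locationFamilyN Sp n)
    (S := fun u => densityN m Sq n u
      / mixtureN (multivariateGaussian m ((n : ℝ)⁻¹ • (Sq - Sp))) Sp n u) (by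
      rintro _ ⟨m', rfl⟩
      exact ⟨inferInstance, iid_multivariateGaussian_absolutelyContinuous hSp m',
        lintegral_densityN_div_mixtureN_le_one hSp hSq h m m' hn⟩)
  have hfam : locationFamilyN Sp n = Set.range fun m' => volume.withDensity fun u =>
      ENNReal.ofReal (Real.exp (logDensityN m' Sp n u)) := by
    rw [locationFamilyN]
    simp_rw [iid_eq_withDensity_exp hSp]
  refine isRIPr_of_lintegral_div_le_one (iid_eq_withDensity hSq m n)
    (measurable_densityN hSq m n) (measurable_mixtureN hSp _) ?_
    (hQ.ae_le (densityN_div_mixtureN_ae_eq hSp hSq h m hn)) hL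
    (fun P hP => ⟨(hC P hP).1, (hC P hP).2.1⟩) (fun P hP => (hC P hP).2.2) fun ε hε => ?_
  · have := lintegral_mul_mixtureN (n := n) hSp
      (multivariateGaussian m ((n : ℝ)⁻¹ • (Sq - Sp))) (measurable_const (a := 1))
    simp only [one_mul, lintegral_const, measure_univ] at this
    exact this.le
  · rw [hfam]
    -- The quadratic forms are nonnegative, so n times the log of the normalizing constant bounds
    -- the log-densities uniformly in the mean.
    have key := exists_mem_convexHull_klDiv_le (ν := volume)
      (l := fun m u => logDensityN m Sp n u) (c := ∑ _ : Fin n,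
        -(1 / 2) * Real.log ((2 * Real.pi) ^ d * Sp.det)) (by fun_prop)
      (iid_eq_withDensity_exp hSq m n) hq measurable_logDensityN_uncurry
      continuous_logDensityN_left
      (fun m' u => Finset.sum_le_sum fun i _ => logDensity_le hSp m' (u i))
      (fun m' => by rw [← iid_eq_withDensity_exp hSp]; infer_instance)
      m (integrable_logDensityN hR m Sp)
      (multivariateGaussian m ((n : ℝ)⁻¹ • (Sq - Sp)))
      (lp := fun u => logDensityN m Sq n u - condLog m Sp Sq n u) ?_ (hq.sub hL) hε
    · simpa only [sub_sub_cancel] using key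
    · filter_upwards [hQ.ae_le (mixtureN_ae_eq hSp hSq h m hn)] with u hu
      simp_rw [← densityN_eq_ofReal_exp hSp]
      exact hu

theorem isGrowthOptimal_mixtureN (hSp : Sp.PosDef) (hSq : Sq.PosDef)
    (h : (Sq - Sp).PosSemidef) (m : EuclideanSpace ℝ (Fin d)) (hn : 0 < n) :
    IsGrowthOptimal (iid (multivariateGaussian m Sq) n) (locationFamilyN Sp n)
      (fun u => densityN m Sq n u
        / mixtureN (multivariateGaussian m ((n : ℝ)⁻¹ • (Sq - Sp))) Sp n u) := by
  have hR : MemLp id 2 (multivariateGaussian m Sq) := IsGaussian.memLp_two_id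
  refine isGrowthOptimal_of_lintegral_mul_le_one (iid_eq_withDensity hSq m n)
    (measurable_densityN hSq m n) (measurable_mixtureN hSp _)
    ((iid_multivariateGaussian_absolutelyContinuous hSq m).ae_le
      (densityN_div_mixtureN_ae_eq hSp hSq h m hn)) (integrable_condLog hR m Sp Sq)
    ⟨(measurable_densityN hSq m n).div (measurable_mixtureN hSp _), ?_⟩ fun S' hS' => ?_
  · rintro _ ⟨m', rfl⟩
    exact lintegral_densityN_div_mixtureN_le_one hSp hSq h m m' hn
  · rw [lintegral_mul_mixtureN hSp _ hS'.1]
    calc _ ≤ ∫⁻ _, 1 ∂(multivariateGaussian m ((n : ℝ)⁻¹ • (Sq - Sp))) :=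
          lintegral_mono fun m' => hS'.2 _ ⟨m', rfl⟩
      _ = 1 := by simp

end AntiSimple

end Model

end GaussEVar

/-! ### The theorem -/

open GaussEVar in
theorem mainTheorem4 {d : ℕ} (Sp Sq Sr : Matrix (Fin d) (Fin d) ℝ)
    (hSp : Sp.PosDef) (hSq : Sq.PosDef)
    (μ : EuclideanSpace ℝ (Fin d))
    (R : Measure (EuclideanSpace ℝ (Fin d))) [IsProbabilityMeasure R]
    (hR2 : MemLp id 2 R) (hRmean : ∫ x, x ∂ R = μ)
    (hRcov : ∀ i j, covariance (fun x => x i) (fun x => x j) R = Sr i j) :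
    ∃ D : ℝ, generalizedKL R (density μ Sq) (density μ Sp) = (D : EReal) ∧
      ∀ n : ℕ, 0 < n →
        -- UI
        ((∀ u, uiEVariable μ Sp Sq n u = densityN μ Sq n u / densityN (mle u) Sp n u) ∧
          ePower (iid R n) (uiEVariable μ Sp Sq n) = ((n * D - dTr Sr Sp / 2 : ℝ) : EReal)) ∧
        -- COND
        ((∃ S, IsCondEVariable (locationFamilyN Sp n) (iid (multivariateGaussian μ Sq) n)
            statZ S) ∧
          ∀ S, IsCondEVariable (locationFamilyN Sp n) (iid (multivariateGaussian μ Sq) n)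
              statZ S → R ≪ volume →
            ePower (iid R n) S = (((n - 1) * D : ℝ) : EReal) ∧
            (n - 1) * D = n * D - DSigma Sr Sq Sp) ∧
        -- RIPr and seq-RIPr, simple case
        ((Sp - Sq).PosSemidef →
          IsRIPrEVariable volume (iid (multivariateGaussian μ Sq) n) (densityN μ Sq n)
            (locationFamilyN Sp n) (fun u => densityN μ Sq n u / densityN μ Sp n u) ∧
          IsGrowthOptimal (iid (multivariateGaussian μ Sq) n) (locationFamilyN Sp n)
            (fun u => densityN μ Sq n u / densityN μ Sp n u) ∧
          IsSeqRIPrEVariable volume (multivariateGaussian μ Sq) (density μ Sq)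
            (locationFamily Sp) n (fun u => densityN μ Sq n u / densityN μ Sp n u) ∧
          (∀ S, IsRIPrEVariable volume (iid (multivariateGaussian μ Sq) n) (densityN μ Sq n)
              (locationFamilyN Sp n) S →
            S =ᵐ[volume] fun u => densityN μ Sq n u / densityN μ Sp n u) ∧
          (∀ S, IsSeqRIPrEVariable volume (multivariateGaussian μ Sq) (density μ Sq)
              (locationFamily Sp) n S →
            S =ᵐ[volume] fun u => densityN μ Sq n u / densityN μ Sp n u) ∧
          ePower (iid R n) (fun u => densityN μ Sq n u / densityN μ Sp n u)
            = ((n * D : ℝ) : EReal) ∧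
          (R ≪ volume → ∀ S, IsRIPrEVariable volume (iid (multivariateGaussian μ Sq) n)
              (densityN μ Sq n) (locationFamilyN Sp n) S →
            ePower (iid R n) S = ((n * D : ℝ) : EReal))) ∧
        -- seq-RIPr and RIPr, anti-simple case
        ((Sq - Sp).PosSemidef →
          IsSeqRIPrEVariable volume (multivariateGaussian μ Sq) (density μ Sq)
            (locationFamily Sp) n (fun _ => 1) ∧
          (∀ S, IsSeqRIPrEVariable volume (multivariateGaussian μ Sq) (density μ Sq)
              (locationFamily Sp) n S → S =ᵐ[volume] fun _ => 1) ∧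
          IsRIPr volume (iid (multivariateGaussian μ Sq) n)
            (convexHull NNReal (locationFamilyN Sp n))
            (mixtureN (multivariateGaussian μ ((n : ℝ)⁻¹ • (Sq - Sp))) Sp n) ∧
          IsGrowthOptimal (iid (multivariateGaussian μ Sq) n) (locationFamilyN Sp n)
            (fun u => densityN μ Sq n u /
              mixtureN (multivariateGaussian μ ((n : ℝ)⁻¹ • (Sq - Sp))) Sp n u) ∧
          (∀ S, IsRIPrEVariable volume (iid (multivariateGaussian μ Sq) n) (densityN μ Sq n)
              (locationFamilyN Sp n) S →
            S =ᵐ[volume] fun u => densityN μ Sq n u /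
              mixtureN (multivariateGaussian μ ((n : ℝ)⁻¹ • (Sq - Sp))) Sp n u) ∧
          (∀ S, IsCondEVariable (locationFamilyN Sp n) (iid (multivariateGaussian μ Sq) n)
              statZ S →
            S =ᵐ[volume] fun u => densityN μ Sq n u /
              mixtureN (multivariateGaussian μ ((n : ℝ)⁻¹ • (Sq - Sp))) Sp n u)) := by
  refine ⟨gaussKL Sp Sq Sr, ?_, fun n hn => ⟨⟨uiEVariable_eq hSp hn μ,
    ePower_uiEVariable hSp hSq hR2 hRmean hRcov hn⟩,
    ⟨exists_isCondEVariable_gaussian hSp μ hn, fun S hS hac =>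
      ⟨ePower_of_isCondEVariable hSp hSq hR2 hRmean hRcov hn hac hS, ?_⟩⟩,
    fun h => ?_, fun h => ?_⟩⟩
  · rw [generalizedKL, ePower_eq_integral
      (ae_of_all _ fun x => density_div_density hSp hSq μ μ x)
      ((integrable_logDensity hR2 μ Sq).sub (integrable_logDensity hR2 μ Sp)),
      integral_logDensity_sub hR2 hRmean hRcov]
  -- The two expressions agree since D is the Gaussian divergence; absolute continuity of `R`
  -- supplies det Σr ≠ 0.
  · rw [← gaussKL_eq_DSigma hSp hSq
      (det_ne_zero_of_absolutelyContinuous hR2 hRmean hRcov hac)]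
    ring
  · have hi : Integrable (fun u => logDensityN μ Sq n u - logDensityN μ Sp n u) (iid R n) :=
      (integrable_logDensityN hR2 μ Sq).sub (integrable_logDensityN hR2 μ Sp)
    have hrip := isRIPr_densityN hSp hSq h μ n
    have hrip₁ := isRIPr_density hSp hSq h μ
    have hpow : ePower (iid R n) (fun u => densityN μ Sq n u / densityN μ Sp n u)
        = ((n * gaussKL Sp Sq Sr : ℝ) : EReal) := by
      rw [ePower_eq_integral (ae_of_all _ fun u => densityN_div_densityN hSp hSq μ μ u) hi,
        integral_logDensityN_sub hR2 hRmean hRcov]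
    refine ⟨⟨_, hrip, rfl⟩, isGrowthOptimal_densityN hSp hSq h μ n,
      ⟨fun _ => density μ Sp, fun _ => hrip₁,
        funext fun u => densityN_div_densityN_eq_prod hSp hSq μ μ u⟩,
      fun S hS => hS.ae_eq_of_isRIPr hSq hrip, fun S hS => ?_, hpow, fun hac S hS => ?_⟩
    · filter_upwards [hS.ae_eq_of_isRIPr hSq hrip₁] with u hu
      rw [hu, densityN_div_densityN_eq_prod hSp hSq]
    · have hae := (absolutelyContinuous_iid hac).ae_le (hS.ae_eq_of_isRIPr hSq hrip)
      rw [ePower_eq_integral (L := fun u => logDensityN μ Sq n u - logDensityN μ Sp n u) ?_ hi,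
        integral_logDensityN_sub hR2 hRmean hRcov]
      filter_upwards [hae] with u hu
      rw [hu, densityN_div_densityN hSp hSq]
  · have hone : ∀ x, density μ Sq x / density μ Sq x = 1 := fun x => by
      rw [density_div_density hSq hSq]; simp
    have hrip := isRIPr_mixtureN hSp hSq h μ hn
    have hrip₁ := isRIPr_density_self hSp hSq h μ
    refine ⟨⟨fun _ => density μ Sq, fun _ => hrip₁, funext fun u => by simp [hone]⟩,
      fun S hS => ?_, hrip, isGrowthOptimal_mixtureN hSp hSq h μ hn,
      fun S hS => hS.ae_eq_of_isRIPr hSq hrip, fun S hS => ?_⟩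
    · filter_upwards [hS.ae_eq_of_isRIPr hSq hrip₁] with u hu
      simp [hu, hone]
    · filter_upwards [hS.ae_eq_exp_condLog hSp hSq hn,
        densityN_div_mixtureN_ae_eq hSp hSq h μ hn] with u h1 h2
      rw [h1, h2]
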